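/- A lattice $3$-polytope is the convex hull in $\mathbb{R}^3$ of finitely many points of $\mathbb{Z}^3$ that contains four affinely independent points; its size is its number of lattice points. For a lattice $3$-polytope $P$ of size $5$ with $P\cap\mathbb{Z}^3=\{p_1,\dots,p_5\}$, the points $p_1,\dots,p_5$ have a unique affine dependence $\sum_i v_ip_i=0$, $\sum_i v_i=0$ (up to a nonzero factor). $P$ has signature $(4,1)$ if, up to a global sign, this dependence has four positive coefficients and one negative coefficient. The dependence normalized so that, for each $i$, $|v_i|$ is the normalized volume of the (possibly degenerate) tetrahedron spanned by the other four points is called the volume vector $(v_1,\dots,v_5)$ of $P$ with respect to the given order of the points; it is defined up to a global sign. Here the normalized volume of a tetrahedron with vertices $a,b,c,d$ is $\left|\det\begin{pmatrix}1&1&1&1\\a&b&c&d\end{pmatrix}\right|$. Two polytopes $P,Q$ are $\mathbb{Z}$-equivalent if $t(P)=Q$ for some affine map $t:\mathbb{R}^3\to\mathbb{R}^3$ of determinant $\pm1$ with $t(\mathbb{Z}^3)=\mathbb{Z}^3$. **Theorem.** Let $P$ be a lattice $3$-polytope of size $5$ and signature $(4,1)$ which does not have, in any order of its lattice points, a volume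 vector $(-4q,q,q,q,q)$ with $q$ a positive integer. Then $P$ is $\mathbb{Z}$-equivalent to the convex hull of the points $(0,0,0)$, $(1,0,0)$, $(0,0,1)$ together with one of the following six pairs of points: 1. $(1,2,1)$ and $(-1,-1,-1)$, with volume vector $(-5,1,1,1,2)$; 2. $(1,3,1)$ and $(-1,-2,-1)$, with volume vector $(-7,1,1,2,3)$; 3. $(2,5,1)$ and $(-1,-2,-1)$, with volume vector $(-11,1,3,2,5)$; 4. $(2,5,1)$ and $(-1,-1,-1)$, with volume vector $(-13,3,4,1,5)$; 5. $(2,7,1)$ and $(-1,-2,-1)$, with volume vector $(-17,3,5,2,7)$; 6. $(3,7,1)$ and $(-2,-3,-1)$, with volume vector $(-19,5,4,3,7)$. Moreover, each of these six convex hulls has exactly the five listed points as its lattice points, has signature $(4,1)$, and has the indicated volume vector in the listed order of the points. -/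

import Mathlib

/-- The integer point `x`, viewed as a point of `ℝ^d`. -/
def toReal {d : ℕ} (x : Fin d → ℤ) : Fin d → ℝ := fun i => (x i : ℝ)

/-- A lattice polytope: the convex hull of a finite set of points of `ℤ^d`. -/
def IsLatticePolytope {d : ℕ} (P : Set (Fin d → ℝ)) : Prop :=
  ∃ S : Finset (Fin d → ℤ), P = convexHull ℝ (toReal '' (S : Set (Fin d → ℤ)))

/-- `P` contains `d + 1` affinely independent points. -/
def IsFullDimensional {d : ℕ} (P : Set (Fin d → ℝ)) : Prop :=
  ∃ p : Fin (d + 1) → (Fin d → ℝ), AffineIndependent ℝ p ∧ ∀ i, p i ∈ P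

/-- The lattice points of `P`, that is, `P ∩ ℤ^d`. -/
def latticePoints {d : ℕ} (P : Set (Fin d → ℝ)) : Set (Fin d → ℤ) :=
  {x | toReal x ∈ P}

/-- The size of `P` is its number of lattice points (a polytope is bounded, so this is finite). -/
noncomputable def latticeSize {d : ℕ} (P : Set (Fin d → ℝ)) : ℕ := (latticePoints P).ncard

/-- `p` lists the lattice points of `P`, each exactly once. -/
def EnumeratesLatticePoints {d n : ℕ} (P : Set (Fin d → ℝ)) (p : Fin n → (Fin d → ℤ)) : Prop :=
  Function.Injective p ∧ Set.range p = latticePoints P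

/-- Two subsets of `ℝ^d` are `ℤ`-equivalent if a unimodular affine map that preserves `ℤ^d`
sends the first to the second. -/
def ZEquivalent {d : ℕ} (P Q : Set (Fin d → ℝ)) : Prop :=
  ∃ t : (Fin d → ℝ) ≃ᵃ[ℝ] (Fin d → ℝ),
    |LinearMap.det (t.linear : (Fin d → ℝ) →ₗ[ℝ] (Fin d → ℝ))| = 1 ∧
    t '' Set.range (toReal (d := d)) = Set.range (toReal (d := d)) ∧
    t '' P = Q

/-- The volume of the (possibly degenerate) lattice simplex with vertices `p 0, …, p d`,
normalized to the lattice: the absolute value of the determinant with columns `(1, p j)`. -/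
def normalizedVolume {d : ℕ} (p : Fin (d + 1) → (Fin d → ℤ)) : ℤ :=
  |(Matrix.of fun i j : Fin (d + 1) => (Fin.cons 1 (p j) : Fin (d + 1) → ℤ) i).det|

/-- `v` is a volume vector of the `d + 2` lattice points `p`: it is an affine dependence of
them, normalized so that `|v i|` is the volume of the simplex spanned by the points other
than `p i`. For points that affinely span `ℝ^d` this determines `v` up to a global sign. -/
def IsVolumeVector {d : ℕ} (p : Fin (d + 2) → (Fin d → ℤ)) (v : Fin (d + 2) → ℤ) : Prop :=
  ∑ i, v i • p i = 0 ∧ ∑ i, v i = 0 ∧ ∀ i, |v i| = normalizedVolume fun j => p (i.succAbove j)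

/-- The polytope `P`, of size `d + 2`, has volume vector `v` for some order of its
lattice points. -/
def HasVolumeVector {d : ℕ} (P : Set (Fin d → ℝ)) (v : Fin (d + 2) → ℤ) : Prop :=
  ∃ p : Fin (d + 2) → (Fin d → ℤ), EnumeratesLatticePoints P p ∧ IsVolumeVector p v

/-- The `d`-polytope `P`, of size `d + 2`, has signature `(a, b)`: the affine dependence of its
lattice points (unique up to a nonzero factor if `P` is full-dimensional) has `a` positive and
`b` negative coefficients. Replacing `c` by `-c` identifies `(a, b)` with `(b, a)`. -/
def HasSignature {d : ℕ} (P : Set (Fin d → ℝ)) (a b : ℕ) : Prop :=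
  ∃ (p : Fin (d + 2) → (Fin d → ℤ)) (c : Fin (d + 2) → ℝ),
    EnumeratesLatticePoints P p ∧
    c ≠ 0 ∧ ∑ i, c i • toReal (p i) = 0 ∧ ∑ i, c i = 0 ∧
    {i | 0 < c i}.ncard = a ∧ {i | c i < 0}.ncard = b

/-- The last two points of the six explicit configurations. -/
def extraPoints : Fin 6 → (Fin 3 → ℤ) × (Fin 3 → ℤ) :=
  ![(![1, 2, 1], ![-1, -1, -1]),
    (![1, 3, 1], ![-1, -2, -1]),
    (![2, 5, 1], ![-1, -2, -1]),
    (![2, 5, 1], ![-1, -1, -1]),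
    (![2, 7, 1], ![-1, -2, -1]),
    (![3, 7, 1], ![-2, -3, -1])]

/-- The six explicit configurations of five lattice points. -/
def config (k : Fin 6) : Fin 5 → (Fin 3 → ℤ) :=
  ![![0, 0, 0], ![1, 0, 0], ![0, 0, 1], (extraPoints k).1, (extraPoints k).2]

/-- The volume vectors of the six explicit configurations, in the order of their points. -/
def configVolumeVector : Fin 6 → (Fin 5 → ℤ) :=
  ![![-5, 1, 1, 1, 2],
    ![-7, 1, 1, 2, 3],
    ![-11, 1, 3, 2, 5],
    ![-13, 3, 4, 1, 5],
    ![-17, 3, 5, 2, 7],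
    ![-19, 5, 4, 3, 7]]

/-- The lattice polytopes spanned by the six explicit configurations. -/
def configPolytope (k : Fin 6) : Set (Fin 3 → ℝ) :=
  convexHull ℝ (toReal '' Set.range (config k))

/-! Move the interior lattice point to the origin. The other four points `A i` span a simplex
without further lattice points, and the weights `w`, with sum `N`, are their maximal minors up to a
common sign. The argument lives in the group of integer vectors `c`, read modulo `N`, for which `∑ c
i` and `∑ c i • A i` are divisible by `N`. A residue vector of sum `N` is a lattice point of the
simplex, hence equals `w` unless it is a vertex. Applied to `c` and `-c`, this shows that an element
outside `N ℤ⁴` has no coordinate divisible by `N`, and has residue sum `2N` unless it is `±w` modulo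
`N` (`dvd_of_dvd`, `sum_emod_cases`).

Unless all weights agree (the excluded family), testing `2w` and `-3w` puts the largest weight `k`
strictly between `N/3` and `N/2`. The facet opposite to its vertex is an empty lattice triangle,
hence unimodular in its plane, so the group contains some `v` with last coordinate `-1`
(`exists_mem_eq_neg_one`). With `aᵢ` the other residues of `v`, the residue sums of `κ v` say that
`∑ ⌊κ aᵢ / N⌋` is `κ - 1` for all `0 < κ < N/2` except `κ = k`, where it is `κ - 2`.

For `N > 5` exactly one `aᵢ`, say `a₁`, exceeds `N/2`. Comparing `b = N - a₁` with `a₂ ≥ a₃` gives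
`k a₃ < N`, so `a₃ = 2` and `b = a₂ + 1`. Then `κ = k` is the only `κ < N/2` with a multiple of `N`
in `(κ a₂, κ (a₂ + 1)]`, which bounds `N`; a finite check leaves five weight systems, and `N = 5`
gives the sixth.

Finally, these weights are coprime, so the `A i` generate `ℤ³`; a generating quadruple is determined
up to lattice automorphisms by its linear dependence (`exists_latticeAutomorphism`). -/

/-! ### Arithmetic of the floor-sum condition. -/

/-- If the multiples of `b` and of `a₂, a₃` have matching integer parts below `k`, while at `k` the
integer part of `k b / N` is ahead by one, then `a₃` does not reach `N` up to `k`. -/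
theorem mul_lt_of_floor_cover {N b a₂ a₃ k : ℤ} (hN : 0 < N) (hb : 2 * b < N)
    (ha₃ : 0 < a₃) (h23 : a₃ ≤ a₂)
    (hF : ∀ κ, 0 ≤ κ → κ < k → κ * b / N = κ * a₂ / N + κ * a₃ / N)
    (hFk : k * b / N = k * a₂ / N + k * a₃ / N + 1) : k * a₃ < N := by
  have ha₂ : 0 < a₂ := by omega
  -- least multiple reaching a threshold
  have least : ∀ a T : ℤ, 0 < a → 0 < T → ∃ p, 0 < p ∧ (p - 1) * a < T ∧ T ≤ p * a := by
    intro a T ha hT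
    refine ⟨(T - 1) / a + 1, ?_, ?_, ?_⟩
    · have := Int.ediv_nonneg (show 0 ≤ T - 1 by omega) ha.le
      omega
    · have := Int.ediv_mul_le (T - 1) ha.ne'
      rw [add_sub_cancel_right]
      omega
    · have := Int.lt_ediv_add_one_mul_self (T - 1) ha
      omega
  have mono : ∀ a x y : ℤ, 0 < a → x ≤ y → x * a / N ≤ y * a / N := fun a x y ha h =>
    Int.ediv_le_ediv hN (mul_le_mul_of_nonneg_right h ha.le)
  have fle : ∀ x t : ℤ, t ≤ x / N ↔ t * N ≤ x := fun x t => Int.le_ediv_iff_mul_le hN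
  have flt : ∀ x t : ℤ, x / N < t ↔ x < t * N := fun x t => Int.ediv_lt_iff_lt_mul hN
  by_contra hcon
  push Not at hcon
  -- At `p` the multiples of `a₃` first reach `N`; before `p` the floors of `b` and `a₂` agree.
  obtain ⟨p, hp0, hp1, hp2⟩ := least a₃ N ha₃ hN
  have hpk : p ≤ k := by
    by_contra h
    have : k * a₃ ≤ (p - 1) * a₃ := mul_le_mul_of_nonneg_right (by omega) ha₃.le
    omega
  have e3 : (p - 1) * a₃ / N = 0 :=
    Int.ediv_eq_zero_of_lt (mul_nonneg (by omega) ha₃.le) hp1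
  have e3' : 1 ≤ p * a₃ / N := (fle _ _).2 (by omega)
  have e1 := hF (p - 1) (by omega) (by omega)
  set t := (p - 1) * b / N + 1 with ht
  have hpb : (p - 1) * b < t * N := (flt _ _).1 (by omega)
  have m2 := mono a₂ (p - 1) p ha₂ (by omega)
  -- Since `2 * b < N`, two steps from `p - 1` raise the floor for `b` by at most one, to `t`.
  have hpb1 : p * b / N < t + 1 := (flt _ _).2 (by nlinarith)
  have hpb2 : (p + 1) * b / N < t + 1 := (flt _ _).2 (by nlinarith)
  have hpk' : p < k := by
    rcases hpk.lt_or_eq with h | h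
    · exact h
    · rw [← h] at hFk
      omega
  have e4 := hF p (by omega) hpk'
  have e5 : p * a₂ / N = t - 1 := by omega
  have e6 : 1 ≤ p * a₂ / N :=
    e3'.trans (Int.ediv_le_ediv hN (mul_le_mul_of_nonneg_left h23 hp0.le))
  have hpbt : t * N ≤ p * b := (fle _ _).1 (by omega)
  -- If `r + q ≤ p + 1`, then `a₂` has reached `t * N` by `p + 1`. With the contribution of `a₃` the
  -- floors there sum to at least `t + 1`, more than `b` allows.
  obtain ⟨r, hr0, hr1, hr2⟩ := least a₂ ((t - 1) * N) ha₂ (mul_pos (by omega) hN)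
  obtain ⟨q, hq0, hq1, hq2⟩ := least a₂ N ha₂ hN
  have hrp : r ≤ p - 1 := by
    by_contra h
    have : (t - 1) ≤ (p - 1) * a₂ / N := by omega
    have := (fle _ _).1 this
    have : (p - 1) * a₂ ≤ (r - 1) * a₂ := mul_le_mul_of_nonneg_right (by omega) ha₂.le
    omega
  have hqr : q ≤ r := by
    by_contra h
    have : r * a₂ ≤ (q - 1) * a₂ := mul_le_mul_of_nonneg_right (by omega) ha₂.le
    have : N ≤ (t - 1) * N := by nlinarith
    omega
  have z3 : ∀ κ, 0 ≤ κ → κ ≤ p - 1 → κ * a₃ / N = 0 := fun κ h0 h1 =>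
    le_antisymm (e3 ▸ mono a₃ κ (p - 1) ha₃ h1)
      (Int.ediv_nonneg (mul_nonneg h0 ha₃.le) hN.le)
  have hqb : (q - 1) * b < 1 * N := (flt _ _).1 (by
    rw [hF (q - 1) (by omega) (by omega), z3 _ (by omega) (by omega), add_zero]
    exact (flt _ _).2 (by omega))
  have hrb : (r - 1) * b < (t - 1) * N := (flt _ _).1 (by
    rw [hF (r - 1) (by omega) (by omega), z3 _ (by omega) (by omega), add_zero]
    exact (flt _ _).2 hr1)
  have hb0 : 0 < b := by
    by_contra h
    have : p * b ≤ 0 := mul_nonpos_of_nonneg_of_nonpos hp0.le (by omega)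
    have : 0 < t * N := mul_pos (by omega) hN
    omega
  -- `p * b - (r - 1) * b` exceeds `N`, whereas `(q - 1) * b` is below `N`.
  have hq : q ≤ p - r + 1 := by
    by_contra h
    have : (p - r + 1) * b ≤ (q - 1) * b := mul_le_mul_of_nonneg_right (by omega) hb0.le
    nlinarith
  have e7 : t ≤ (p + 1) * a₂ / N := (fle _ _).2 (by
    have : (r + q) * a₂ ≤ (p + 1) * a₂ := mul_le_mul_of_nonneg_right (by omega) ha₂.le
    nlinarith)
  have e8 := mono a₃ p (p + 1) ha₃ (by omega)
  rcases (show p + 1 ≤ k by omega).lt_or_eq with h | h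
  · have := hF (p + 1) (by omega) h
    omega
  · rw [← h] at hFk
    omega

/-- If only one `κ < N / 2` has a multiple of `N` in `(κ a, κ (a + 1)]`, and it is larger than
`N / 3`, then `N` is bounded. -/
theorem bound_of_unique_jump {N a k : ℤ} (ha : 2 ≤ a) (haN : 2 * (a + 1) < N) (hk : N < 3 * k)
    (H : ∀ κ t, 2 * κ < N → κ * a < t * N → t * N ≤ κ * (a + 1) → κ = k) (hodd : N % 2 = 1) :
    N < 112 ∧ a < 28 := by
  by_contra hcon
  -- Reflection at `N / 2`: with `κ = (N - m) / 2` and `t = (a - i) / 2`, jumps become pairs `(m,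
  -- i)` with `i * N < m * a` and `m * (a + 1) ≤ (i + 1) * N`. Two such pairs with different `m`
  -- contradict uniqueness.
  have H' : ∀ m i, m % 2 = 1 → 0 < m → i % 2 = a % 2 → i * N < m * a → m * (a + 1) ≤ (i + 1) * N →
      m = N - 2 * k := by
    intro m i hm hm0 hi h1 h2
    obtain ⟨κ, hκ⟩ : ∃ κ, N - m = 2 * κ := ⟨(N - m) / 2, by omega⟩
    obtain ⟨t, ht⟩ : ∃ t, a - i = 2 * t := ⟨(a - i) / 2, by omega⟩
    have e1 : 2 * (κ * a) = (N - m) * a := by rw [hκ]; ring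
    have e2 : 2 * (t * N) = (a - i) * N := by rw [ht]; ring
    have e3 : 2 * (κ * (a + 1)) = (N - m) * (a + 1) := by rw [hκ]; ring
    have := H κ t (by omega) (by nlinarith) (by nlinarith)
    omega
  rcases Int.emod_two_eq_zero_or_one a with hpar | hpar
  · have h1 := H' 1 0 (by norm_num) (by norm_num) (by omega)
    have h2 := H' 3 0 (by norm_num) (by norm_num) (by omega)
    have h3 := H' 5 2 (by norm_num) (by norm_num) (by omega)
    have h4 := H' 7 2 (by norm_num) (by norm_num) (by omega)
    omega
  · have hN6 : N < 6 * a + 6 := by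
      by_contra h
      -- With `i = 1` the admissible `m` satisfy `N / a < m ≤ 2 * N / (a + 1)`; for `N ≥ 6 * a + 6`
      -- this range contains two consecutive odd numbers.
      set d := N / a
      have hd1 : d * a ≤ N := Int.ediv_mul_le N (by omega)
      have hd2 : N < (d + 1) * a := Int.lt_ediv_add_one_mul_self N (by omega)
      have hd3 : (d + 4) * (a + 1) ≤ 2 * N := by
        have hd0 : 0 ≤ d := Int.ediv_nonneg (by omega) (by omega)
        have h3 : d * 3 ≤ d * a := mul_le_mul_of_nonneg_left (by omega) hd0
        have : (d + 4) * (a + 1) = d * a + d + 4 * a + 4 := by ring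
        omega
      obtain ⟨m, hm, hm1, hm2⟩ : ∃ m, m % 2 = 1 ∧ d + 1 ≤ m ∧ m ≤ d + 2 := by
        rcases Int.emod_two_eq_zero_or_one d with h | h
        · exact ⟨d + 1, by omega, by omega, by omega⟩
        · exact ⟨d + 2, by omega, by omega, by omega⟩
      have hd0 : 0 ≤ d := Int.ediv_nonneg (by omega) (by omega)
      have h1 := H' m 1 hm (by omega) (by omega) (by nlinarith) (by nlinarith)
      have h2 := H' (m + 2) 1 (by omega) (by omega) (by omega) (by nlinarith) (by nlinarith)
      omega
    -- The windows `m (a + 1) / 2 ≤ N < m a` (for `i = 1`) and `m (a + 1) / 4 ≤ N < m a / 3` (for `i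
    -- = 3`) cover each remaining large `N` at least twice.
    have h3 := H' 3 1 (by norm_num) (by norm_num) (by omega)
    have h5 := H' 5 1 (by norm_num) (by norm_num) (by omega)
    have h7 := H' 7 1 (by norm_num) (by norm_num) (by omega)
    have h9 := H' 9 1 (by norm_num) (by norm_num) (by omega)
    have g7 := H' 7 3 (by norm_num) (by norm_num) (by omega)
    have g9 := H' 9 3 (by norm_num) (by norm_num) (by omega)
    have g11 := H' 11 3 (by norm_num) (by norm_num) (by omega)
    omega
-- Exhaustive search. The gcd tests record that `a₃ = 2`, `a₂ = a` and `a₁ = N - 1 - a` are units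
-- modulo `N`.
theorem uniqueJump_check : ((List.range 112).all fun N => N.gcd 2 != 1 || (List.range 28).all fun a =>
    Nat.ble N (2 * (a + 1)) || N.gcd a != 1 || N.gcd (N - 1 - a) != 1 ||
    (List.range 56).all fun k => Nat.ble (3 * k) N || Nat.ble N (2 * k) ||
      k * (a + 1) / N == k * a / N ||
      ((List.range N).any fun κ => Nat.blt (2 * κ) N && κ != k && κ * a / N != κ * (a + 1) / N) ||
      Nat.blt a 2 ||
      decide ((N, a, k) ∈ [(7, 2, 3), (11, 4, 5), (13, 5, 5), (17, 7, 7), (19, 5, 7)])) = true := by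
  decide +kernel

theorem uniqueJump_classification {N a k : ℕ} (hN : N < 112) (ha : a < 28) (ha2 : 2 ≤ a)
    (haN : 2 * (a + 1) < N) (hNk : N < 3 * k) (hkN : 2 * k < N)
    (h2 : N.gcd 2 = 1) (hga : N.gcd a = 1) (hga' : N.gcd (N - 1 - a) = 1)
    (hk : k * (a + 1) / N ≠ k * a / N)
    (h : ∀ κ, 2 * κ < N → κ ≠ k → κ * a / N = κ * (a + 1) / N) :
    (N, a, k) ∈ [(7, 2, 3), (11, 4, 5), (13, 5, 5), (17, 7, 7), (19, 5, 7)] := by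
  have := uniqueJump_check
  simp only [List.all_eq_true, List.mem_range, Bool.or_eq_true, decide_eq_true_eq, List.any_eq_true,
    Nat.blt_eq, Nat.ble_eq, bne_iff_ne, beq_iff_eq, Bool.and_eq_true] at this
  rcases this N hN with h' | h'
  · exact absurd h2 h'
  rcases h' a ha with ((h' | h') | h') | h'
  · omega
  · exact absurd hga h'
  · exact absurd hga' h'
  rcases h' k (by omega) with ((((h' | h') | h') | ⟨κ, -, ⟨h1, h2⟩, h3⟩) | h') | h'
  · omega
  · omega
  · exact absurd h' hk
  · exact absurd (h κ h1 h2) h3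
  · omega
  · exact h'

theorem gcd_eq_one_of_not_dvd_mul {N : ℕ} {a : ℤ} (hN : 0 < N)
    (hz : ∀ κ : ℤ, 0 < κ → κ < N → ¬ (N : ℤ) ∣ κ * a) : N.gcd a.natAbs = 1 := by
  by_contra hd
  set d := N.gcd a.natAbs
  have hd0 : 0 < d := Nat.gcd_pos_of_pos_left _ hN
  obtain ⟨e, he⟩ : d ∣ N := Nat.gcd_dvd_left _ _
  obtain ⟨f, hf⟩ : (d : ℤ) ∣ a := Int.natCast_dvd.2 (Nat.gcd_dvd_right _ _)
  have he0 : 0 < e := by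
    rcases Nat.eq_zero_or_pos e with h | h
    · rw [h] at he; omega
    · exact h
  refine hz e (by omega) ?_ ⟨f, ?_⟩
  · have : e * 2 ≤ e * d := Nat.mul_le_mul_left _ (by omega)
    have : e < N := by rw [he, mul_comm]; omega
    exact_mod_cast this
  · rw [hf, he]; push_cast; ring

/-- Complementing `a₁` turns the floor sums into a comparison of `b = N - a₁` with `a₂` and `a₃`.
Then `k * a₃ < N < 3 * k` leaves only `a₃ = 2`, which makes `κ = k` a unique jump. -/
theorem ordered_floor_cover_classification {N k a₁ a₂ a₃ : ℤ} (hN : 6 ≤ N)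
    (h1N : a₁ < N) (h3 : 2 ≤ a₃) (h23 : a₃ ≤ a₂) (hsum : a₁ + a₂ + a₃ = N + 1) (h1 : N < 2 * a₁)
    (hNk : N < 3 * k) (hkN : 2 * k < N)
    (hz₁ : ∀ κ, 0 < κ → κ < N → ¬ N ∣ κ * a₁) (hz₂ : ∀ κ, 0 < κ → κ < N → ¬ N ∣ κ * a₂)
    (hz₃ : ∀ κ, 0 < κ → κ < N → ¬ N ∣ κ * a₃)
    (hF : ∀ κ, 0 < κ → 2 * κ < N → κ ≠ k → κ * a₁ / N + κ * a₂ / N + κ * a₃ / N = κ - 1)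
    (hFk : k * a₁ / N + k * a₂ / N + k * a₃ / N = k - 2) :
    a₃ = 2 ∧ (N.toNat, a₂.toNat, k.toNat) ∈
      [(7, 2, 3), (11, 4, 5), (13, 5, 5), (17, 7, 7), (19, 5, 7)] := by
  have hN0 : 0 < N := by omega
  have hcompl : ∀ κ, 0 < κ → κ < N → κ * a₁ / N = κ - 1 - κ * (N - a₁) / N := by
    intro κ h0 hκ
    have hz := hz₁ κ h0 hκ
    have e1 : κ * a₁ = -(κ * (N - a₁)) + N * κ := by ring
    have hz' : ¬ N ∣ κ * (N - a₁) := fun h => hz (by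
      rw [e1]; exact (dvd_neg.2 h).add (dvd_mul_right _ _))
    have hpos : κ * (N - a₁) % N ≠ 0 := fun h => hz' (Int.dvd_of_emod_eq_zero h)
    rw [e1, Int.add_mul_ediv_left _ _ hN0.ne']
    have h2 := Int.emod_nonneg (κ * (N - a₁)) hN0.ne'
    have h3 := Int.emod_lt_of_pos (κ * (N - a₁)) hN0
    have h4 := Int.mul_ediv_add_emod (κ * (N - a₁)) N
    have h5 : 0 < κ * (N - a₁) % N := by omega
    have : -(κ * (N - a₁)) / N = -(κ * (N - a₁) / N) - 1 := by
      generalize κ * (N - a₁) = y at h2 h3 h4 h5 ⊢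
      rw [Int.ediv_eq_iff_of_pos hN0]
      constructor <;> nlinarith
    omega
  have hG : ∀ κ, 0 < κ → 2 * κ < N → κ ≠ k →
      κ * (N - a₁) / N = κ * a₂ / N + κ * a₃ / N := by
    intro κ h0 hκ hk
    have := hF κ h0 hκ hk
    have := hcompl κ h0 (by omega)
    omega
  have hGk : k * (N - a₁) / N = k * a₂ / N + k * a₃ / N + 1 := by
    have := hcompl k (by omega) (by omega)
    omega
  have hlt := mul_lt_of_floor_cover (N := N) (b := N - a₁) (a₂ := a₂) (a₃ := a₃) (k := k) hN0
    (by omega) (by omega) h23 (fun κ h0 hκ => by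
      rcases h0.eq_or_lt with h | h
      · simp [← h]
      · exact hG κ h (by omega) (by omega)) hGk
  have ha3 : a₃ = 2 := by
    by_contra h
    have : k * 3 ≤ k * a₃ := mul_le_mul_of_nonneg_left (by omega) (by omega)
    omega
  subst ha3
  refine ⟨rfl, ?_⟩
  have hb : N - a₁ = a₂ + 1 := by omega
  rw [hb] at hG hGk
  have z2 : ∀ κ, 0 < κ → 2 * κ < N → κ * 2 / N = 0 := fun κ h0 h =>
    Int.ediv_eq_zero_of_lt (by omega) (by omega)
  have hodd : N % 2 = 1 := by
    by_contra h
    exact hz₃ (N / 2) (by omega) (by omega) ⟨1, by omega⟩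
  have hjump : ∀ κ, 0 < κ → 2 * κ < N → κ ≠ k → κ * (a₂ + 1) / N = κ * a₂ / N := by
    intro κ h0 h hk
    have := hG κ h0 h hk
    have := z2 κ h0 h
    omega
  have hbd := bound_of_unique_jump (N := N) (a := a₂) (k := k) h23 (by omega) hNk (by
    intro κ t hκ h1 h2
    by_contra hk
    have hκ0 : 0 < κ := by nlinarith
    have := hjump κ hκ0 hκ hk
    have := (Int.le_ediv_iff_mul_le hN0).2 h2
    have := (Int.ediv_lt_iff_lt_mul hN0).2 h1
    omega) hodd
  lift N to ℕ using by omega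
  lift k to ℕ using by omega
  lift a₂ to ℕ using by omega
  have hc2 := gcd_eq_one_of_not_dvd_mul (by omega) hz₂
  have hc1 := gcd_eq_one_of_not_dvd_mul (by omega) hz₁
  have e1 : a₁.natAbs = N - 1 - a₂ := by omega
  rw [e1] at hc1
  refine uniqueJump_classification (by omega) (by omega) (by omega) (by omega) (by omega) (by omega)
    ?_ hc2 hc1 ?_ ?_
  · have := gcd_eq_one_of_not_dvd_mul (by omega) hz₃
    exact this
  · intro h
    have := z2 k (by omega) (by omega)
    have h' : (k : ℤ) * (a₂ + 1) / N = k * a₂ / N := by exact_mod_cast h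
    omega
  · intro κ h hk
    rcases Nat.eq_zero_or_pos κ with h0 | h0
    · simp [h0]
    · exact_mod_cast (hjump κ (by omega) (by omega) (by omega)).symm

/-- The weights of the vertices in the `j`-th configuration. -/
def configWeights (j : Fin 6) : Multiset ℤ :=
  Finset.univ.val.map fun i : Fin 4 => configVolumeVector j i.succ

theorem weights_of_ordered_floor_cover {N k a₁ a₂ a₃ : ℤ} (hN : 6 ≤ N)
    (h1N : a₁ < N) (h2 : 2 ≤ a₂) (h3 : 2 ≤ a₃) (hsum : a₁ + a₂ + a₃ = N + 1) (h1 : N < 2 * a₁)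
    (hNk : N < 3 * k) (hkN : 2 * k < N)
    (hz₁ : ∀ κ, 0 < κ → κ < N → ¬ N ∣ κ * a₁) (hz₂ : ∀ κ, 0 < κ → κ < N → ¬ N ∣ κ * a₂)
    (hz₃ : ∀ κ, 0 < κ → κ < N → ¬ N ∣ κ * a₃)
    (hF : ∀ κ, 0 < κ → 2 * κ < N → κ ≠ k → κ * a₁ / N + κ * a₂ / N + κ * a₃ / N = κ - 1)
    (hFk : k * a₁ / N + k * a₂ / N + k * a₃ / N = k - 2) :
    ∃ j, ({-(k * a₁) % N, -(k * a₂) % N, -(k * a₃) % N, k} : Multiset ℤ) = configWeights j := by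
  wlog h23 : a₃ ≤ a₂ generalizing a₂ a₃
  · obtain ⟨j, hj⟩ := this h3 h2 (by omega) hz₃ hz₂
      (fun κ h0 h hk => by have := hF κ h0 h hk; omega) (by omega) (by omega)
    refine ⟨j, ?_⟩
    rw [← hj]
    simp only [Multiset.insert_eq_cons]
    rw [Multiset.cons_swap (-(k * a₂) % N)]
  obtain ⟨rfl, h⟩ := ordered_floor_cover_classification hN h1N h3 h23 hsum h1 hNk hkN hz₁ hz₂ hz₃ hF hFk
  obtain rfl : a₁ = N - 1 - a₂ := by omega
  lift N to ℕ using by omega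
  lift k to ℕ using by omega
  lift a₂ to ℕ using by omega
  simp only [Int.toNat_natCast, List.mem_cons, Prod.mk.injEq, List.not_mem_nil, or_false] at h
  rcases h with ⟨rfl, rfl, rfl⟩ | ⟨rfl, rfl, rfl⟩ | ⟨rfl, rfl, rfl⟩ | ⟨rfl, rfl, rfl⟩ | ⟨rfl, rfl, rfl⟩
  · exact ⟨1, by decide⟩
  · exact ⟨2, by decide⟩
  · exact ⟨3, by decide⟩
  · exact ⟨4, by decide⟩
  · exact ⟨5, by decide⟩

/-- As all `aᵢ ≥ 2`, the sum condition gives `N ≥ 5`, and `N = 5` forces the first configuration.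
For larger `N`, `k ≠ 2`, so the floor sum at `κ = 2` is `1`: exactly one `aᵢ` exceeds `N / 2`. -/
theorem weights_of_floor_cover {N k a₁ a₂ a₃ : ℤ}
    (h1N : a₁ < N) (h2N : a₂ < N) (h3N : a₃ < N)
    (h1 : 2 ≤ a₁) (h2 : 2 ≤ a₂) (h3 : 2 ≤ a₃) (hsum : a₁ + a₂ + a₃ = N + 1)
    (hNk : N < 3 * k) (hkN : 2 * k < N)
    (hz₁ : ∀ κ, 0 < κ → κ < N → ¬ N ∣ κ * a₁) (hz₂ : ∀ κ, 0 < κ → κ < N → ¬ N ∣ κ * a₂)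
    (hz₃ : ∀ κ, 0 < κ → κ < N → ¬ N ∣ κ * a₃)
    (hF : ∀ κ, 0 < κ → 2 * κ < N → κ ≠ k → κ * a₁ / N + κ * a₂ / N + κ * a₃ / N = κ - 1)
    (hFk : k * a₁ / N + k * a₂ / N + k * a₃ / N = k - 2) :
    ∃ j, ({-(k * a₁) % N, -(k * a₂) % N, -(k * a₃) % N, k} : Multiset ℤ) = configWeights j := by
  rcases le_or_gt N 5 with hN | hN
  · obtain rfl : N = 5 := by omega
    obtain rfl : k = 2 := by omega
    obtain rfl : a₁ = 2 := by omega
    obtain rfl : a₂ = 2 := by omega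
    obtain rfl : a₃ = 2 := by omega
    exact ⟨0, by decide⟩
  have hdiv : ∀ a : ℤ, 2 ≤ a → a < N → (∀ κ, 0 < κ → κ < N → ¬ N ∣ κ * a) →
      (2 * a < N ∧ 2 * a / N = 0) ∨ (N < 2 * a ∧ 2 * a / N = 1) := by
    intro a h0 ha hz
    rcases lt_trichotomy (2 * a) N with h | h | h
    · exact Or.inl ⟨h, Int.ediv_eq_zero_of_lt (by omega) h⟩
    · exact absurd ⟨1, by omega⟩ (hz 2 (by omega) (by omega))
    · exact Or.inr ⟨h, by rw [Int.ediv_eq_iff_of_pos (by omega)]; constructor <;> omega⟩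
  have e := hF 2 (by omega) (by omega) (by omega)
  have d1 := hdiv a₁ h1 h1N hz₁
  have d2 := hdiv a₂ h2 h2N hz₂
  have d3 := hdiv a₃ h3 h3N hz₃
  have hc : N < 2 * a₁ ∨ N < 2 * a₂ ∨ N < 2 * a₃ := by omega
  rcases hc with h | h | h
  · exact weights_of_ordered_floor_cover (by omega) h1N h2 h3 hsum h hNk hkN hz₁ hz₂ hz₃ hF hFk
  · obtain ⟨j, hj⟩ := weights_of_ordered_floor_cover (by omega) h2N h1 h3 (by omega) h hNk hkN
      hz₂ hz₁ hz₃ (fun κ h0 h hk => by have := hF κ h0 h hk; omega) (by omega)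
    refine ⟨j, hj ▸ ?_⟩
    simp only [Multiset.insert_eq_cons]
    rw [Multiset.cons_swap]
  · obtain ⟨j, hj⟩ := weights_of_ordered_floor_cover (by omega) h3N h2 h1 (by omega) h hNk hkN
      hz₃ hz₂ hz₁ (fun κ h0 h hk => by have := hF κ h0 h hk; omega) (by omega)
    refine ⟨j, hj ▸ ?_⟩
    simp only [Multiset.insert_eq_cons]
    rw [Multiset.cons_swap (-(k * a₁) % N), Multiset.cons_swap (-(k * a₁) % N),
      Multiset.cons_swap (-(k * a₂) % N)]

/-! ### Barycentric coordinates modulo `N`. -/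

/-- The integer coefficient vectors `c` for which both `∑ c i` and the combination `∑ c i • A i` are
divisible by `N`: up to the factor `N`, the barycentric coordinates of lattice points. -/
def barycentricLattice (N : ℤ) (A : Fin 4 → Fin 3 → ℤ) : AddSubgroup (Fin 4 → ℤ) where
  carrier := {c | N ∣ ∑ i, c i ∧ ∀ j, N ∣ ∑ i, c i * A i j}
  zero_mem' := by simp
  add_mem' := by
    rintro c d ⟨hc, hc'⟩ ⟨hd, hd'⟩
    refine ⟨?_, fun j => ?_⟩
    · simpa [Finset.sum_add_distrib] using dvd_add hc hd
    · simpa [Finset.sum_add_distrib, add_mul] using dvd_add (hc' j) (hd' j)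
  neg_mem' := by
    rintro c ⟨hc, hc'⟩
    refine ⟨?_, fun j => ?_⟩
    · simpa using hc
    · simpa using hc' j

/-- The simplex with vertices `A` contains the origin in its interior, with barycentric
coordinates `w / N`, and it has no lattice points besides the origin and its vertices. -/
structure HasOnlyInteriorPoint (N : ℤ) (A : Fin 4 → Fin 3 → ℤ) (w : Fin 4 → ℤ) : Prop where
  pos : ∀ i, 0 < w i
  sum : ∑ i, w i = N
  mem : w ∈ barycentricLattice N A
  eq_or_eq : ∀ c ∈ barycentricLattice N A, (∀ i, 0 ≤ c i) → ∑ i, c i = N →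
    c = w ∨ ∃ j, c = Pi.single j N

namespace HasOnlyInteriorPoint

variable {N : ℤ} {A : Fin 4 → Fin 3 → ℤ} {w : Fin 4 → ℤ}

theorem N_pos (h : HasOnlyInteriorPoint N A w) : 0 < N :=
  h.sum ▸ Finset.sum_pos (fun i _ => h.pos i) Finset.univ_nonempty

theorem sum_four (h : HasOnlyInteriorPoint N A w) : w 0 + w 1 + w 2 + w 3 = N := by
  rw [← Fin.sum_univ_four, h.sum]

theorem lt (h : HasOnlyInteriorPoint N A w) (i : Fin 4) : w i < N := by
  have := h.sum_four
  have := h.pos 0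
  have := h.pos 1
  have := h.pos 2
  have := h.pos 3
  fin_cases i <;> simp <;> omega

theorem emod_mem {c : Fin 4 → ℤ} (hc : c ∈ barycentricLattice N A) :
    (fun i => c i % N) ∈ barycentricLattice N A := by
  have key : (fun i => N * (c i / N)) ∈ barycentricLattice N A := by
    refine ⟨Finset.dvd_sum fun i _ => dvd_mul_right _ _, fun j => Finset.dvd_sum fun i _ => ?_⟩
    rw [mul_assoc]
    exact dvd_mul_right _ _
  convert sub_mem hc key using 1
  ext i
  have := Int.mul_ediv_add_emod (c i) N
  simp only [Pi.sub_apply]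
  omega

theorem emod_eq_of_sum (h : HasOnlyInteriorPoint N A w) {c : Fin 4 → ℤ}
    (hc : c ∈ barycentricLattice N A) (hs : ∑ i, c i % N = N) (i : Fin 4) : c i % N = w i := by
  rcases h.eq_or_eq _ (emod_mem hc) (fun i => Int.emod_nonneg _ h.N_pos.ne') hs with h' | ⟨j, hj⟩
  · exact congrFun h' i
  · have := congrFun hj j
    rw [Pi.single_eq_same] at this
    have := Int.emod_lt_of_pos (c j) h.N_pos
    omega

theorem emod_add_neg_emod {x : ℤ} (hN : 0 < N) (hx : ¬ N ∣ x) : x % N + -x % N = N := by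
  have h1 := Int.emod_nonneg x hN.ne'
  have h2 := Int.emod_lt_of_pos x hN
  have h3 : x % N ≠ 0 := fun h => hx (Int.dvd_of_emod_eq_zero h)
  have h4 := Int.mul_ediv_add_emod x N
  have : -x = (N - x % N) + N * (-(x / N) - 1) := by linarith
  have h5 : -x % N = N - x % N := by
    rw [this, Int.add_mul_emod_self_left]
    exact Int.emod_eq_of_lt (by omega) (by omega)
  omega

/-- The residues sum up to a multiple of `N`. -/
theorem exists_sum_emod {c : Fin 4 → ℤ} (hc : c ∈ barycentricLattice N A) :
    ∃ m, c 0 % N + c 1 % N + c 2 % N + c 3 % N = N * m := by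
  obtain ⟨m, hm⟩ := (emod_mem hc).1
  exact ⟨m, by rw [← hm, Fin.sum_univ_four]⟩

/-- Otherwise the residue sums of `c` and `-c` are positive multiples of `N` with total below `4 *
N`, so one of them is `N`. It gives a lattice point on the facet `i` which is not a vertex. -/
theorem dvd_of_dvd (h : HasOnlyInteriorPoint N A w) {c : Fin 4 → ℤ}
    (hc : c ∈ barycentricLattice N A) {i : Fin 4} (hi : N ∣ c i) (j : Fin 4) : N ∣ c j := by
  by_contra hj
  have hN := h.N_pos
  have hc' : -c ∈ barycentricLattice N A := neg_mem hc
  have n1 : ∀ i, 0 ≤ c i % N := fun i => Int.emod_nonneg _ hN.ne'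
  have n2 : ∀ i, 0 ≤ (-c) i % N := fun i => Int.emod_nonneg _ hN.ne'
  have n3 : ∀ i, c i % N + (-c) i % N ≤ N := by
    intro i
    by_cases hd : N ∣ c i
    · have e1 := Int.emod_eq_zero_of_dvd hd
      have e2 : (-c) i % N = 0 := Int.emod_eq_zero_of_dvd (dvd_neg.2 hd)
      omega
    · exact (emod_add_neg_emod hN hd).le
  have z1 : c i % N = 0 := Int.emod_eq_zero_of_dvd hi
  have z2 : (-c) i % N = 0 := Int.emod_eq_zero_of_dvd (dvd_neg.2 hi)
  have p1 : 0 < c j % N := (n1 j).lt_of_ne' fun h => hj (Int.dvd_of_emod_eq_zero h)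
  have p2 : 0 < (-c) j % N := (n2 j).lt_of_ne' fun h => hj (dvd_neg.1 (Int.dvd_of_emod_eq_zero h))
  have s1 : 0 < ∑ i, c i % N := Finset.sum_pos' (fun i _ => n1 i) ⟨j, Finset.mem_univ _, p1⟩
  have s2 : 0 < ∑ i, (-c) i % N := Finset.sum_pos' (fun i _ => n2 i) ⟨j, Finset.mem_univ _, p2⟩
  have s3 : ∑ i, c i % N + ∑ i, (-c) i % N < 4 * N := by
    rw [← Finset.sum_add_distrib]
    calc ∑ i, (c i % N + (-c) i % N) < ∑ _i : Fin 4, N :=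
          Finset.sum_lt_sum (fun i _ => n3 i) ⟨i, Finset.mem_univ _, by omega⟩
      _ = 4 * N := by simp
  obtain ⟨m, hm⟩ := (emod_mem hc).1
  obtain ⟨m', hm'⟩ := (emod_mem hc').1
  rw [hm] at s1 s3
  rw [hm'] at s2 s3
  have m1 : 0 < m := pos_of_mul_pos_right s1 hN.le
  have m2 : 0 < m' := pos_of_mul_pos_right s2 hN.le
  have m3 : m + m' < 4 := by nlinarith
  have := h.pos i
  rcases (show m = 1 ∨ m' = 1 by omega) with rfl | rfl
  · have := h.emod_eq_of_sum hc (by rw [hm, mul_one]) i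
    omega
  · have := h.emod_eq_of_sum hc' (by rw [hm', mul_one]) i
    omega

/-- All residues lie strictly between `0` and `N`, so their sum is `N`, `2 * N` or `3 * N`; negation
exchanges the outer cases. -/
theorem sum_emod_cases (h : HasOnlyInteriorPoint N A w) {c : Fin 4 → ℤ}
    (hc : c ∈ barycentricLattice N A) {i : Fin 4} (hi : ¬ N ∣ c i) :
    (∀ j, c j % N = w j) ∨ (∀ j, -c j % N = w j) ∨
      c 0 % N + c 1 % N + c 2 % N + c 3 % N = 2 * N := by
  have hN := h.N_pos
  have hnd : ∀ j, ¬ N ∣ c j := fun j hj => hi (h.dvd_of_dvd hc hj i)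
  have n1 : ∀ i, 0 < c i % N := fun i =>
    (Int.emod_nonneg _ hN.ne').lt_of_ne' fun h => hnd i (Int.dvd_of_emod_eq_zero h)
  have n2 : ∀ i, c i % N < N := fun i => Int.emod_lt_of_pos _ hN
  have n3 : ∀ i, c i % N + -c i % N = N := fun i => emod_add_neg_emod hN (hnd i)
  obtain ⟨m, hm⟩ := exists_sum_emod hc
  have a0 := n1 0; have a1 := n1 1; have a2 := n1 2; have a3 := n1 3
  have b0 := n2 0; have b1 := n2 1; have b2 := n2 2; have b3 := n2 3
  have d0 := n3 0; have d1 := n3 1; have d2 := n3 2; have d3 := n3 3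
  have m1 : 0 < m := by
    by_contra h
    nlinarith
  have m2 : m < 4 := by
    by_contra h
    nlinarith
  rcases (show m = 1 ∨ m = 2 ∨ m = 3 by omega) with rfl | rfl | rfl
  · refine Or.inl (h.emod_eq_of_sum hc ?_)
    rw [Fin.sum_univ_four]
    omega
  · exact Or.inr (Or.inr (by omega))
  · refine Or.inr (Or.inl fun j => h.emod_eq_of_sum (neg_mem hc) ?_ j)
    simp only [Fin.sum_univ_four, Pi.neg_apply]
    omega

theorem smul_mem {c : Fin 4 → ℤ} (κ : ℤ) (hc : c ∈ barycentricLattice N A) :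
    (fun i => κ * c i) ∈ barycentricLattice N A := by
  have := zsmul_mem hc κ
  rwa [show κ • c = fun i => κ * c i from by ext; simp] at this

/-- The largest weight lies strictly between a third and a half of the total weight. -/
theorem max_weight_bounds (h : HasOnlyInteriorPoint N A w) (hmax : ∀ i, w i ≤ w 3)
    (hne : ¬ ∀ i, w i = w 3) : N < 3 * w 3 ∧ 2 * w 3 < N := by
  have hN := h.N_pos
  have hs := h.sum_four
  have p0 := h.pos 0; have p1 := h.pos 1; have p2 := h.pos 2; have p3 := h.pos 3
  have q0 := hmax 0; have q1 := hmax 1; have q2 := hmax 2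
  have hlt := h.lt 3
  have h2 := smul_mem 2 h.mem
  have h3 := smul_mem 3 h.mem
  have half : 2 * w 3 < N := by
    by_contra hcon
    rcases (not_lt.1 hcon).eq_or_lt with he | hgt
    · obtain ⟨t, ht⟩ := h.dvd_of_dvd h2 (i := 3) ⟨1, by omega⟩ 0
      have : 0 < t := by
        by_contra h
        nlinarith
      have : N ≤ 2 * w 0 := by nlinarith
      omega
    -- Only the last coordinate of `2w` wraps around, so the residue sum is `N` and the residues
    -- would have to be `w`.
    · have e0 : 2 * w 0 % N = 2 * w 0 := Int.emod_eq_of_lt (by omega) (by omega)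
      have e1 : 2 * w 1 % N = 2 * w 1 := Int.emod_eq_of_lt (by omega) (by omega)
      have e2 : 2 * w 2 % N = 2 * w 2 := Int.emod_eq_of_lt (by omega) (by omega)
      have e3 : 2 * w 3 % N = 2 * w 3 - N := by
        rw [← Int.sub_emod_right, Int.emod_eq_of_lt (by omega) (by omega)]
      have := h.emod_eq_of_sum h2 (by rw [Fin.sum_univ_four]; omega) 0
      omega
  refine ⟨?_, half⟩
  by_contra hcon
  rcases (not_lt.1 hcon).eq_or_lt with he | hgt
  · have hi : ∀ i, N ≤ 3 * w i := by
      intro i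
      obtain ⟨t, ht⟩ := h.dvd_of_dvd h3 (i := 3) ⟨1, by omega⟩ i
      have := h.pos i
      have : 0 < t := by
        by_contra h
        nlinarith
      nlinarith
    have := hi 0; have := hi 1; have := hi 2
    omega
  -- The residues `N - 3 * w i` of `-3w` sum to `4 * N - 3 * N`, so they equal `w`, making all
  -- weights `N / 4`.
  · have e : ∀ i, (-fun i => 3 * w i) i % N = N - 3 * w i := by
      intro i
      have := h.pos i
      have := hmax i
      rw [Pi.neg_apply, ← Int.add_emod_right, Int.emod_eq_of_lt (by omega) (by omega)]
      omega
    refine hne fun i => ?_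
    have hw : ∀ i, N - 3 * w i = w i := fun i => by
      refine (e i).symm.trans (h.emod_eq_of_sum (neg_mem h3) ?_ i)
      rw [Fin.sum_univ_four, e, e, e, e]
      omega
    have := hw i
    have := hw 3
    omega

/-- If some lattice point is at distance one from the last facet, then the weights are those of
one of the six configurations. -/
theorem weights_eq (h : HasOnlyInteriorPoint N A w) (hNk : N < 3 * w 3) (hkN : 2 * w 3 < N)
    {v : Fin 4 → ℤ} (hv : v ∈ barycentricLattice N A) (hv3 : v 3 = -1) :
    ∃ j, ({w 0, w 1, w 2, w 3} : Multiset ℤ) = configWeights j := by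
  have hN := h.N_pos
  have hs := h.sum_four
  have p0 := h.pos 0; have p1 := h.pos 1; have p2 := h.pos 2; have p3 := h.pos 3
  set k := w 3 with hk
  have hdvd : ∀ i, N ∣ w i + k * v i := by
    refine h.dvd_of_dvd (c := fun i => w i + k * v i) (add_mem h.mem (smul_mem k hv)) (i := 3) ?_
    simp [hv3, ← hk]
  have hndvd : ∀ i κ, 0 < κ → κ < N → ¬ N ∣ κ * v i := by
    intro i κ h0 h1 hd
    have := h.dvd_of_dvd (smul_mem κ hv) hd 3
    rw [hv3, mul_neg_one, dvd_neg] at this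
    exact absurd (Int.le_of_dvd h0 this) (by omega)
  have res : ∀ i κ, κ * v i % N = κ * (v i % N) % N := by
    intro i κ
    rw [Int.mul_emod, Int.mul_emod κ (v i % N), Int.emod_emod]
  have hz : ∀ i κ, 0 < κ → κ < N → ¬ N ∣ κ * (v i % N) := by
    intro i κ h0 h1 hd
    refine hndvd i κ h0 h1 (Int.dvd_of_emod_eq_zero ?_)
    rw [res]
    exact Int.emod_eq_zero_of_dvd hd
  have hlt : ∀ i, v i % N < N := fun i => Int.emod_lt_of_pos _ hN
  -- Residue `1` would give `N ∣ w i + k`, but `0 < w i + k < N` because the other two weights are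
  -- positive.
  have hge : ∀ i : Fin 4, i ≠ 3 → 2 ≤ v i % N := by
    intro i hi
    have h0 := Int.emod_nonneg (v i) hN.ne'
    have h1 : v i % N ≠ 0 := fun h => hndvd i 1 one_pos (by omega)
      (by rw [one_mul]; exact Int.dvd_of_emod_eq_zero h)
    have h2 : v i % N ≠ 1 := by
      intro he
      have h3 : N ∣ w i + k := by
        have e := Int.mul_ediv_add_emod (v i) N
        have : w i + k = (w i + k * v i) - N * (k * (v i / N)) := by
          rw [he] at e
          generalize v i / N = t at e ⊢
          rw [← e]
          ring
        rw [this]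
        exact dvd_sub (hdvd i) (dvd_mul_right _ _)
      have h4 : 0 < w i + k := by have := h.pos i; omega
      have := Int.le_of_dvd h4 h3
      fin_cases i <;> simp at this hi <;> omega
    omega
  have hsum : ∀ κ, 0 < κ → κ < N →
      κ * v 0 % N + κ * v 1 % N + κ * v 2 % N = κ * (v 0 % N) + κ * (v 1 % N) + κ * (v 2 % N)
        - N * (κ * (v 0 % N) / N + κ * (v 1 % N) / N + κ * (v 2 % N) / N) ∧
      κ * v 3 % N = N - κ ∧ -(κ * v 3) % N = κ := by
    intro κ h0 h1
    refine ⟨?_, ?_, ?_⟩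
    · have e0 := Int.mul_ediv_add_emod (κ * (v 0 % N)) N
      have e1 := Int.mul_ediv_add_emod (κ * (v 1 % N)) N
      have e2 := Int.mul_ediv_add_emod (κ * (v 2 % N)) N
      rw [res, res, res, mul_add, mul_add]
      linarith
    · rw [hv3, mul_neg_one, ← Int.add_emod_right, Int.emod_eq_of_lt (by omega) (by omega)]
      omega
    · rw [hv3, mul_neg_one, neg_neg, Int.emod_eq_of_lt (by omega) (by omega)]
  have hN1 : 1 < N := by omega
  have ha : v 0 % N + v 1 % N + v 2 % N = N + 1 := by
    obtain ⟨-, e2, e3⟩ := hsum 1 one_pos hN1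
    have c := h.sum_emod_cases (smul_mem 1 hv) (i := 3) (hndvd 3 1 one_pos hN1)
    simp only [one_mul] at e2 e3 c
    rcases c with c | c | c
    · have := c 3
      omega
    · have := c 3
      omega
    · omega
  have hw : ∀ i, -(k * (v i % N)) % N = w i := by
    intro i
    rw [Int.neg_emod_eq_sub_emod, Int.sub_emod, ← res, ← Int.sub_emod, ← Int.neg_emod_eq_sub_emod]
    obtain ⟨t, ht⟩ := hdvd i
    rw [show -(k * v i) = w i + N * (-t) by rw [mul_neg, ← ht]; ring, Int.add_mul_emod_self_left,
      Int.emod_eq_of_lt (h.pos i).le (h.lt i)]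
  -- The last residue of `κ v` is `N - κ`. For `κ < N / 2` it exceeds `k`, so `κ v` is not `w`; and
  -- it is `-w` only at `κ = k`, where the residue sum is `3 * N`.
  obtain ⟨j, hj⟩ := weights_of_floor_cover (hlt 0) (hlt 1) (hlt 2) (hge 0 (by decide))
    (hge 1 (by decide)) (hge 2 (by decide)) ha hNk hkN (hz 0) (hz 1) (hz 2) (by
      intro κ h0 h1 hne
      obtain ⟨e1, e2, e3⟩ := hsum κ h0 (by omega)
      rcases h.sum_emod_cases (smul_mem κ hv) (i := 3) (hndvd 3 κ h0 (by omega)) with c | c | c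
      · have := c 3
        omega
      · have := c 3
        omega
      · have e4 : κ * (v 0 % N) + κ * (v 1 % N) + κ * (v 2 % N) = κ * (N + 1) := by rw [← ha]; ring
        refine mul_left_cancel₀ hN.ne' ?_
        linarith) (by
      obtain ⟨e1, e2, e3⟩ := hsum k p3 (by omega)
      have r : ∀ i, k * v i % N = N - w i := by
        intro i
        obtain ⟨t, ht⟩ := hdvd i
        have := h.pos i
        have := h.lt i
        rw [show k * v i = (N - w i) + N * (t - 1) by rw [mul_sub, ← ht]; ring,
          Int.add_mul_emod_self_left, Int.emod_eq_of_lt (by omega) (by omega)]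
      rw [r, r, r] at e1
      have e4 : k * (v 0 % N) + k * (v 1 % N) + k * (v 2 % N) = k * (N + 1) := by rw [← ha]; ring
      refine mul_left_cancel₀ hN.ne' ?_
      linarith)
  rw [hw, hw, hw] at hj
  exact ⟨j, hj⟩

end HasOnlyInteriorPoint

/-! ### Maximal minors and Cramer's rule. -/

/-- The determinant of three vectors. -/
def det3 {R : Type*} [CommRing R] (u v t : Fin 3 → R) : R :=
  u 0 * (v 1 * t 2 - v 2 * t 1) - u 1 * (v 0 * t 2 - v 2 * t 0) + u 2 * (v 0 * t 1 - v 1 * t 0)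

/-- The signed maximal minors of four vectors, in the signs that make them a linear dependence. -/
def minors {R : Type*} [CommRing R] (A : Fin 4 → Fin 3 → R) : Fin 4 → R :=
  ![det3 (A 1) (A 2) (A 3), -det3 (A 0) (A 2) (A 3), det3 (A 0) (A 1) (A 3),
    -det3 (A 0) (A 1) (A 2)]

section minors

variable {R : Type*} [CommRing R] (A : Fin 4 → Fin 3 → R)

theorem sum_minors_mul (j : Fin 3) : ∑ i, minors A i * A i j = 0 := by
  rw [Fin.sum_univ_four]
  fin_cases j <;> simp [minors, det3] <;> ring

/-- Pairing the dependence with the cross product of two of the vectors eliminates them and relates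
the two remaining coefficients. No rank assumption is needed. -/
theorem mul_minors_comm {c : Fin 4 → R} (hc : ∀ j, ∑ i, c i * A i j = 0) (i j : Fin 4) :
    c i * minors A j = c j * minors A i := by
  have h0 := hc 0
  have h1 := hc 1
  have h2 := hc 2
  rw [Fin.sum_univ_four] at h0 h1 h2
  have e01 : c 0 * minors A 1 = c 1 * minors A 0 := by
    simp only [minors, det3, Matrix.cons_val]
    linear_combination -(A 2 1 * A 3 2 - A 2 2 * A 3 1) * h0 + (A 2 0 * A 3 2 - A 2 2 * A 3 0) * h1
      - (A 2 0 * A 3 1 - A 2 1 * A 3 0) * h2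
  have e02 : c 0 * minors A 2 = c 2 * minors A 0 := by
    simp only [minors, det3, Matrix.cons_val]
    linear_combination (A 1 1 * A 3 2 - A 1 2 * A 3 1) * h0 - (A 1 0 * A 3 2 - A 1 2 * A 3 0) * h1
      + (A 1 0 * A 3 1 - A 1 1 * A 3 0) * h2
  have e03 : c 0 * minors A 3 = c 3 * minors A 0 := by
    simp only [minors, det3, Matrix.cons_val]
    linear_combination -(A 1 1 * A 2 2 - A 1 2 * A 2 1) * h0 + (A 1 0 * A 2 2 - A 1 2 * A 2 0) * h1
      - (A 1 0 * A 2 1 - A 1 1 * A 2 0) * h2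
  have e12 : c 1 * minors A 2 = c 2 * minors A 1 := by
    simp only [minors, det3, Matrix.cons_val]
    linear_combination -(A 0 1 * A 3 2 - A 0 2 * A 3 1) * h0 + (A 0 0 * A 3 2 - A 0 2 * A 3 0) * h1
      - (A 0 0 * A 3 1 - A 0 1 * A 3 0) * h2
  have e13 : c 1 * minors A 3 = c 3 * minors A 1 := by
    simp only [minors, det3, Matrix.cons_val]
    linear_combination (A 0 1 * A 2 2 - A 0 2 * A 2 1) * h0 - (A 0 0 * A 2 2 - A 0 2 * A 2 0) * h1
      + (A 0 0 * A 2 1 - A 0 1 * A 2 0) * h2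
  have e23 : c 2 * minors A 3 = c 3 * minors A 2 := by
    simp only [minors, det3, Matrix.cons_val]
    linear_combination -(A 0 1 * A 1 2 - A 0 2 * A 1 1) * h0 + (A 0 0 * A 1 2 - A 0 2 * A 1 0) * h1
      - (A 0 0 * A 1 1 - A 0 1 * A 1 0) * h2
  fin_cases i <;> fin_cases j <;>
    first
      | rfl
      | exact e01
      | exact e02
      | exact e03
      | exact e12
      | exact e13
      | exact e23
      | exact e01.symm
      | exact e02.symm
      | exact e03.symm
      | exact e12.symm
      | exact e13.symm
      | exact e23.symm

/-- A multiple of any vector by any of the minors is a combination of the given vectors. -/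
theorem exists_minor_smul_eq (i : Fin 4) (x : Fin 3 → R) :
    ∃ e : Fin 4 → R, ∀ j, minors A i * x j = ∑ l, e l * A l j := by
  fin_cases i
  · refine ⟨![0, det3 x (A 2) (A 3), det3 (A 1) x (A 3), det3 (A 1) (A 2) x], fun j => ?_⟩
    rw [Fin.sum_univ_four]
    fin_cases j <;> simp [minors, det3] <;> ring
  · refine ⟨![-det3 x (A 2) (A 3), 0, -det3 (A 0) x (A 3), -det3 (A 0) (A 2) x], fun j => ?_⟩
    rw [Fin.sum_univ_four]
    fin_cases j <;> simp [minors, det3] <;> ring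
  · refine ⟨![det3 x (A 1) (A 3), det3 (A 0) x (A 3), 0, det3 (A 0) (A 1) x], fun j => ?_⟩
    rw [Fin.sum_univ_four]
    fin_cases j <;> simp [minors, det3] <;> ring
  · refine ⟨![-det3 x (A 1) (A 2), -det3 (A 0) x (A 2), -det3 (A 0) (A 1) x, 0], fun j => ?_⟩
    rw [Fin.sum_univ_four]
    fin_cases j <;> simp [minors, det3] <;> ring

/-- Minors generating the unit ideal make the vectors generate the whole lattice. -/
theorem exists_combination_of_sum_minors {β : Fin 4 → R} (hβ : ∑ i, β i * minors A i = 1)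
    (x : Fin 3 → R) : ∃ e : Fin 4 → R, ∀ j, x j = ∑ l, e l * A l j := by
  choose e he using fun i => exists_minor_smul_eq A i x
  refine ⟨fun l => ∑ i, β i * e i l, fun j => ?_⟩
  calc x j = ∑ i, β i * (minors A i * x j) := by
        simp_rw [← mul_assoc, ← Finset.sum_mul, hβ, one_mul]
    _ = ∑ l, (∑ i, β i * e i l) * A l j := by
        simp_rw [he, Finset.mul_sum, Finset.sum_mul]
        rw [Finset.sum_comm]
        simp_rw [mul_assoc]

end minors

theorem normalizedVolume_eq (p : Fin 4 → Fin 3 → ℤ) :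
    normalizedVolume p = |det3 (p 1 - p 0) (p 2 - p 0) (p 3 - p 0)| := by
  rw [normalizedVolume]
  congr 1
  have h2 : ∀ x : Fin 3 → ℤ, (Fin.cons 1 x : Fin 4 → ℤ) 2 = x 1 := fun _ => rfl
  have h3 : ∀ x : Fin 3 → ℤ, (Fin.cons 1 x : Fin 4 → ℤ) 3 = x 2 := fun _ => rfl
  simp [Matrix.det_succ_row_zero, Fin.sum_univ_succ, det3, Fin.succAbove, h2, h3]
  ring

/-! ### Unimodularity of the facet opposite to the last vertex. -/

namespace HasOnlyInteriorPoint

variable {N : ℤ} {A : Fin 4 → Fin 3 → ℤ} {w : Fin 4 → ℤ}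

/-- If the two edge vectors were dependent modulo `p`, a combination of them divided by `p` would be
a lattice vector in the facet plane. Its last barycentric coordinate is zero, against `dvd_of_dvd`.
-/
theorem not_prime_dvd_cross (h : HasOnlyInteriorPoint N A w) {p : ℤ} (hp : Prime p) (hpN : p ∣ N)
    (hd : ∀ i j, p ∣ (A 0 i - A 2 i) * (A 1 j - A 2 j) - (A 0 j - A 2 j) * (A 1 i - A 2 i)) :
    False := by
  obtain ⟨M, hM⟩ := hpN
  have hN := h.N_pos
  have hM0 : M ≠ 0 := by rintro rfl; omega
  have hU : ∀ i, p ∣ A 0 i - A 2 i := by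
    intro i
    have hc : ![M * (A 1 i - A 2 i), -(M * (A 0 i - A 2 i)),
        M * (A 0 i - A 2 i) - M * (A 1 i - A 2 i), 0] ∈ barycentricLattice N A := by
      refine ⟨Dvd.intro 0 ?_, fun j => ?_⟩
      · rw [Fin.sum_univ_four]
        simp only [Matrix.cons_val]
        ring
      · obtain ⟨t, ht⟩ := hd i j
        rw [Fin.sum_univ_four, hM]
        refine ⟨-t, ?_⟩
        simp only [Matrix.cons_val]
        linear_combination (-M) * ht
    have := h.dvd_of_dvd hc (i := 3) (by simp) 1
    simp only [Matrix.cons_val] at this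
    rw [dvd_neg, hM, mul_comm p] at this
    exact (mul_dvd_mul_iff_left hM0).1 this
  have hc : ![M, 0, -M, 0] ∈ barycentricLattice N A := by
    refine ⟨?_, fun j => ?_⟩
    · rw [Fin.sum_univ_four]
      simp
    · obtain ⟨t, ht⟩ := hU j
      rw [Fin.sum_univ_four, hM]
      refine ⟨t, ?_⟩
      simp only [Matrix.cons_val]
      linear_combination M * ht
  have := h.dvd_of_dvd hc (i := 3) (by simp) 0
  simp only [Matrix.cons_val] at this
  rw [hM] at this
  have : p * M ∣ 1 * M := by rwa [one_mul]
  exact hp.not_isUnit (isUnit_of_dvd_one ((mul_dvd_mul_iff_right hM0).1 this))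

theorem exists_bezout_of_not_prime {a b c : ℤ}
    (h : ∀ p : ℤ, Prime p → p ∣ a → p ∣ b → p ∣ c → False) : ∃ x y z, a * x + b * y + c * z = 1 := by
  have hg : Int.gcd (Int.gcd a b) c = 1 := by
    by_contra hne
    obtain ⟨p, hp, hpd⟩ := Nat.exists_prime_and_dvd hne
    have hpd' : (p : ℤ) ∣ (Int.gcd (Int.gcd a b) c : ℤ) := Int.natCast_dvd_natCast.2 hpd
    have h1 := hpd'.trans (Int.gcd_dvd_left _ _)
    exact h p (Nat.prime_iff_prime_int.1 hp) (h1.trans (Int.gcd_dvd_left _ _))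
      (h1.trans (Int.gcd_dvd_right _ _)) (hpd'.trans (Int.gcd_dvd_right _ _))
  have e1 := Int.gcd_eq_gcd_ab a b
  have e2 := Int.gcd_eq_gcd_ab (Int.gcd a b) c
  rw [hg] at e2
  refine ⟨Int.gcdA a b * Int.gcdA (Int.gcd a b) c, Int.gcdB a b * Int.gcdA (Int.gcd a b) c,
    Int.gcdB (Int.gcd a b) c, ?_⟩
  push_cast at e2
  linear_combination -e2 - Int.gcdA (Int.gcd a b) c * e1

/-- Some lattice point has lattice distance one from the facet opposite to the last vertex. -/
theorem exists_mem_eq_neg_one (h : HasOnlyInteriorPoint N A w) {s : ℤ} (hs : s * s = 1)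
    (hw : ∀ i, w i = s * minors A i) : ∃ v ∈ barycentricLattice N A, v 3 = -1 := by
  set n0 := (A 0 1 - A 2 1) * (A 1 2 - A 2 2) - (A 0 2 - A 2 2) * (A 1 1 - A 2 1) with hn0
  set n1 := (A 0 2 - A 2 2) * (A 1 0 - A 2 0) - (A 0 0 - A 2 0) * (A 1 2 - A 2 2) with hn1
  set n2 := (A 0 0 - A 2 0) * (A 1 1 - A 2 1) - (A 0 1 - A 2 1) * (A 1 0 - A 2 0) with hn2
  have hdet : n0 * (A 3 0 - A 2 0) + n1 * (A 3 1 - A 2 1) + n2 * (A 3 2 - A 2 2) = s * N := by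
    have e0 := hw 0
    have e1 := hw 1
    have e2 := hw 2
    have e3 := hw 3
    have hN := h.sum_four
    have : N = s * (minors A 0 + minors A 1 + minors A 2 + minors A 3) := by
      rw [← hN, e0, e1, e2, e3]; ring
    rw [this, ← mul_assoc, hs]
    simp only [minors, det3, Matrix.cons_val, hn0, hn1, hn2]
    ring
  have hN : N = s * (s * N) := by rw [← mul_assoc, hs, one_mul]
  -- By `hdet`, a prime dividing the normal vector divides `N`, so the normal is primitive.
  obtain ⟨x0, x1, x2, hx⟩ : ∃ x y z, n0 * x + n1 * y + n2 * z = 1 := by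
    refine exists_bezout_of_not_prime fun p hp h0 h1 h2 => h.not_prime_dvd_cross hp ?_ ?_
    · rw [hN, ← hdet]
      exact ((((h0.mul_right _).add (h1.mul_right _)).add (h2.mul_right _))).mul_left _
    · intro i j
      fin_cases i <;> fin_cases j <;> simp only [Fin.mk_one, Fin.zero_eta, Fin.reduceFinMk]
      · simp
      · exact h2
      · rw [← dvd_neg]; exact h1.trans (dvd_of_eq (by rw [hn1]; ring))
      · rw [← dvd_neg]; exact h2.trans (dvd_of_eq (by rw [hn2]; ring))
      · simp
      · exact h0
      · exact h1
      · rw [← dvd_neg]; exact h0.trans (dvd_of_eq (by rw [hn0]; ring))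
      · simp
  -- Cramer's rule: `s * N * x` is `a` and `b` times the edges at `A 2` plus `n · x = 1` times `A 3
  -- - A 2`. The witness is the negative of this, with coefficient sum `0`.
  set a := det3 ![x0, x1, x2] (A 1 - A 2) (A 3 - A 2) with ha
  set b := det3 (A 0 - A 2) ![x0, x1, x2] (A 3 - A 2) with hb
  refine ⟨![-a, -b, a + b + 1, -1], ⟨?_, fun j => ?_⟩, rfl⟩
  · rw [Fin.sum_univ_four]
    simp only [Matrix.cons_val]
    ring_nf
    exact dvd_zero N
  · rw [Fin.sum_univ_four]
    refine ⟨-(s * ![x0, x1, x2] j), ?_⟩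
    simp only [Matrix.cons_val]
    rw [show N * -(s * ![x0, x1, x2] j) = -(s * N) * ![x0, x1, x2] j by ring, ← hdet]
    simp only [det3, Matrix.cons_val, Pi.sub_apply] at ha hb
    fin_cases j <;> simp only [Fin.mk_one, Fin.zero_eta, Fin.reduceFinMk, Matrix.cons_val] <;>
      rw [ha, hb]
    · linear_combination (A 3 0 - A 2 0) * hx
    · linear_combination (A 3 1 - A 2 1) * hx
    · linear_combination (A 3 2 - A 2 2) * hx

end HasOnlyInteriorPoint

/-! ### The six explicit configurations. -/

/-- An integral linear inequality that holds for the points `p` holds for the lattice points of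
their convex hull. -/
theorem linear_le_of_mem_latticePoints {ι : Type*} {p : ι → Fin 3 → ℤ} {n₀ n₁ n₂ b : ℤ}
    (h : ∀ i, n₀ * p i 0 + n₁ * p i 1 + n₂ * p i 2 ≤ b) {x : Fin 3 → ℤ}
    (hx : x ∈ latticePoints (convexHull ℝ (toReal '' Set.range p))) :
    n₀ * x 0 + n₁ * x 1 + n₂ * x 2 ≤ b := by
  have key : convexHull ℝ (toReal '' Set.range p) ⊆
      {y | (n₀ : ℝ) * y 0 + n₁ * y 1 + n₂ * y 2 ≤ b} := by
    refine convexHull_min ?_ ?_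
    · rintro _ ⟨_, ⟨i, rfl⟩, rfl⟩
      have := h i
      simp only [toReal, Set.mem_ofPred_eq]
      exact_mod_cast this
    · refine convex_halfSpace_le (f := fun y : Fin 3 → ℝ => (n₀ : ℝ) * y 0 + n₁ * y 1 + n₂ * y 2)
        ⟨fun y z => ?_, fun c y => ?_⟩ _
      · simp only [Pi.add_apply]; ring
      · simp only [Pi.smul_apply, smul_eq_mul]; ring
  have := key hx
  simp only [toReal, Set.mem_ofPred_eq] at this
  exact_mod_cast this

/-- In each case `h1`, …, `h4` are the four facet inequalities of the simplex; they bound the last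
two coordinates, and the remaining values are enumerated. -/
theorem latticePoint_configPolytope (k : Fin 6) {x : Fin 3 → ℤ}
    (hx : x ∈ latticePoints (configPolytope k)) : x ∈ Set.range (config k) := by
  have hx' : ∀ n₀ n₁ n₂ b : ℤ, (∀ i, n₀ * config k i 0 + n₁ * config k i 1 + n₂ * config k i 2 ≤ b) →
      n₀ * x 0 + n₁ * x 1 + n₂ * x 2 ≤ b := fun n₀ n₁ n₂ b h => linear_le_of_mem_latticePoints h hx
  have of_eq : ∀ i, x 0 = config k i 0 ∧ x 1 = config k i 1 ∧ x 2 = config k i 2 →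
      x ∈ Set.range (config k) := by
    rintro i ⟨h0, h1, h2⟩
    refine ⟨i, ?_⟩
    ext j
    fin_cases j
    · exact h0.symm
    · exact h1.symm
    · exact h2.symm
  have of_or : ∀ u v : Fin 3 → ℤ, extraPoints k = (u, v) →
      (x 0 = 0 ∧ x 1 = 0 ∧ x 2 = 0) ∨ (x 0 = 1 ∧ x 1 = 0 ∧ x 2 = 0) ∨
      (x 0 = 0 ∧ x 1 = 0 ∧ x 2 = 1) ∨ (x 0 = u 0 ∧ x 1 = u 1 ∧ x 2 = u 2) ∨
      (x 0 = v 0 ∧ x 1 = v 1 ∧ x 2 = v 2) → x ∈ Set.range (config k) := by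
    rintro u v huv (h | h | h | h | h)
    · exact of_eq 0 h
    · exact of_eq 1 h
    · exact of_eq 2 h
    · exact of_eq 3 (by simpa [config, huv] using h)
    · exact of_eq 4 (by simpa [config, huv] using h)
  clear hx of_eq
  fin_cases k
  · have h1 := hx' (-4) 2 1 1 (by decide)
    have h2 := hx' 1 2 (-4) 1 (by decide)
    have h3 := hx' 1 (-3) 1 1 (by decide)
    have h4 := hx' 2 (-1) 2 2 (by decide)
    refine of_or _ _ rfl ?_
    simp only [Matrix.cons_val]
    clear hx' of_or
    generalize x 0 = a at *
    generalize x 1 = b at *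
    generalize x 2 = c at *
    obtain ⟨hb1, hb2⟩ : -1 ≤ b ∧ b ≤ 2 := by omega
    obtain ⟨hc1, hc2⟩ : -1 ≤ c ∧ c ≤ 1 := by omega
    interval_cases b <;> interval_cases c <;> omega
  · have h1 := hx' (-6) 2 1 1 (by decide)
    have h2 := hx' 1 2 (-6) 1 (by decide)
    have h3 := hx' 2 (-3) 2 2 (by decide)
    have h4 := hx' 3 (-1) 3 3 (by decide)
    refine of_or _ _ rfl ?_
    simp only [Matrix.cons_val]
    clear hx' of_or
    generalize x 0 = a at *
    generalize x 1 = b at *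
    generalize x 2 = c at *
    obtain ⟨hb1, hb2⟩ : -2 ≤ b ∧ b ≤ 3 := by omega
    obtain ⟨hc1, hc2⟩ : -1 ≤ c ∧ c ≤ 1 := by omega
    interval_cases b <;> interval_cases c <;> omega
  · have h1 := hx' (-10) 4 1 1 (by decide)
    have h2 := hx' 3 1 (-8) 3 (by decide)
    have h3 := hx' 2 (-3) 2 2 (by decide)
    have h4 := hx' 5 (-2) 5 5 (by decide)
    refine of_or _ _ rfl ?_
    simp only [Matrix.cons_val]
    clear hx' of_or
    generalize x 0 = a at *
    generalize x 1 = b at *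
    generalize x 2 = c at *
    obtain ⟨hb1, hb2⟩ : -2 ≤ b ∧ b ≤ 5 := by omega
    obtain ⟨hc1, hc2⟩ : -1 ≤ c ∧ c ≤ 1 := by omega
    interval_cases b <;> interval_cases c <;> omega
  · have h1 := hx' (-10) 4 3 3 (by decide)
    have h2 := hx' 4 1 (-9) 4 (by decide)
    have h3 := hx' 1 (-3) 1 1 (by decide)
    have h4 := hx' 5 (-2) 5 5 (by decide)
    refine of_or _ _ rfl ?_
    simp only [Matrix.cons_val]
    clear hx' of_or
    generalize x 0 = a at *
    generalize x 1 = b at *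
    generalize x 2 = c at *
    obtain ⟨hb1, hb2⟩ : -1 ≤ b ∧ b ≤ 5 := by omega
    obtain ⟨hc1, hc2⟩ : -1 ≤ c ∧ c ≤ 1 := by omega
    interval_cases b <;> interval_cases c <;> omega
  · have h1 := hx' (-14) 4 3 3 (by decide)
    have h2 := hx' 5 1 (-12) 5 (by decide)
    have h3 := hx' 2 (-3) 2 2 (by decide)
    have h4 := hx' 7 (-2) 7 7 (by decide)
    refine of_or _ _ rfl ?_
    simp only [Matrix.cons_val]
    clear hx' of_or
    generalize x 0 = a at *
    generalize x 1 = b at *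
    generalize x 2 = c at *
    obtain ⟨hb1, hb2⟩ : -2 ≤ b ∧ b ≤ 7 := by omega
    obtain ⟨hc1, hc2⟩ : -1 ≤ c ∧ c ≤ 1 := by omega
    interval_cases b <;> interval_cases c <;> omega
  · have h1 := hx' (-14) 6 5 5 (by decide)
    have h2 := hx' 4 1 (-15) 4 (by decide)
    have h3 := hx' 3 (-4) 3 3 (by decide)
    have h4 := hx' 7 (-3) 7 7 (by decide)
    refine of_or _ _ rfl ?_
    simp only [Matrix.cons_val]
    clear hx' of_or
    generalize x 0 = a at *
    generalize x 1 = b at *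
    generalize x 2 = c at *
    obtain ⟨hb1, hb2⟩ : -3 ≤ b ∧ b ≤ 7 := by omega
    obtain ⟨hc1, hc2⟩ : -1 ≤ c ∧ c ≤ 1 := by omega
    interval_cases b <;> interval_cases c <;> omega

theorem enumerates_config (k : Fin 6) :
    EnumeratesLatticePoints (configPolytope k) (config k) := by
  refine ⟨?_, Set.Subset.antisymm ?_ fun x hx => latticePoint_configPolytope k hx⟩
  · revert k
    decide
  · rintro _ ⟨i, rfl⟩
    exact subset_convexHull ℝ _ ⟨_, ⟨i, rfl⟩, rfl⟩

theorem sum_configVolumeVector_smul (k : Fin 6) :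
    ∑ i, configVolumeVector k i • config k i = 0 := by
  revert k
  decide

theorem sum_configVolumeVector (k : Fin 6) : ∑ i, configVolumeVector k i = 0 := by
  revert k
  decide

theorem isVolumeVector_config (k : Fin 6) : IsVolumeVector (config k) (configVolumeVector k) := by
  refine ⟨sum_configVolumeVector_smul k, sum_configVolumeVector k, fun i => ?_⟩
  rw [normalizedVolume_eq]
  revert k i
  decide

theorem hasSignature_config (k : Fin 6) : HasSignature (configPolytope k) 4 1 := by
  refine ⟨config k, fun i => (configVolumeVector k i : ℝ), enumerates_config k, ?_, ?_, ?_, ?_, ?_⟩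
  · intro h
    have := congrFun h 0
    simp only [Pi.zero_apply, Int.cast_eq_zero] at this
    clear h
    revert this k
    decide
  · ext j
    have := congrFun (sum_configVolumeVector_smul k) j
    simp only [Finset.sum_apply, Pi.smul_apply, smul_eq_mul, Pi.zero_apply, toReal] at this ⊢
    exact_mod_cast this
  · beta_reduce
    exact_mod_cast sum_configVolumeVector k
  · have : {i | 0 < (configVolumeVector k i : ℝ)} =
        ((Finset.univ.filter fun i => 0 < configVolumeVector k i : Finset (Fin 5)) : Set (Fin 5)) := by
      ext i
      simp
    rw [this, Set.ncard_coe_finset]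
    clear this
    revert k
    decide
  · have : {i | (configVolumeVector k i : ℝ) < 0} =
        ((Finset.univ.filter fun i => configVolumeVector k i < 0 : Finset (Fin 5)) : Set (Fin 5)) := by
      ext i
      simp
    rw [this, Set.ncard_coe_finset]
    clear this
    revert k
    decide

/-! ### From the polytope to its weights. -/

/-- Sorting the coefficients puts the interior point at index `0` and the vertex of largest weight
last. -/
theorem exists_sorted_enumeration {P : Set (Fin 3 → ℝ)} (h : HasSignature P 4 1) :
    ∃ (p : Fin 5 → Fin 3 → ℤ) (c : Fin 5 → ℝ), EnumeratesLatticePoints P p ∧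
      ∑ i, c i • toReal (p i) = 0 ∧ ∑ i, c i = 0 ∧ c 0 < 0 ∧ (∀ i : Fin 4, 0 < c i.succ) ∧
      ∀ i : Fin 4, c i.succ ≤ c 4 := by
  obtain ⟨p, c, ⟨hinj, hrange⟩, -, hdep, hsum, hpos, hneg⟩ := h
  set σ := Tuple.sort c
  have hmono : Monotone (c ∘ σ) := Tuple.monotone_sort c
  have hc0 : c (σ 0) < 0 := by
    obtain ⟨i, hi⟩ : {i | c i < 0}.Nonempty := by
      rw [← Set.ncard_pos, hneg]
      norm_num
    have := hmono (Fin.zero_le (σ.symm i))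
    simp only [Function.comp_apply, Equiv.apply_symm_apply] at this
    exact this.trans_lt hi
  have hc1 : 0 < c (σ 1) := by
    by_contra hcon
    have hsub : {i | 0 < c i} ⊆ ((Finset.univ.filter fun i => 1 < σ.symm i : Finset (Fin 5)) :
        Set (Fin 5)) := by
      intro i hi
      simp only [Finset.coe_filter, Finset.mem_univ, true_and, Set.mem_ofPred_eq]
      by_contra hle
      have := hmono (not_lt.1 hle)
      simp only [Function.comp_apply, Equiv.apply_symm_apply] at this
      exact hcon (lt_of_lt_of_le hi this)
    have h1 := Set.ncard_le_ncard hsub (Finset.finite_toSet _)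
    have h2 : (Finset.univ.filter fun i => 1 < σ.symm i : Finset (Fin 5)).card =
        (Finset.univ.filter fun i : Fin 5 => 1 < i : Finset (Fin 5)).card :=
      Finset.card_bij (fun i _ => σ.symm i) (by simp) (by simp) (fun i hi => ⟨σ i, by simpa using hi⟩)
    rw [hpos, Set.ncard_coe_finset, h2] at h1
    revert h1
    clear * -
    decide
  refine ⟨p ∘ σ, c ∘ σ, ⟨hinj.comp σ.injective, by rw [EquivLike.range_comp, hrange]⟩, ?_, ?_, hc0,
    fun i => hc1.trans_le (hmono (Fin.succ_le_succ_iff.2 (Fin.zero_le i))), fun i => hmono (Fin.le_last _)⟩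
  · rw [← hdep]
    exact Equiv.sum_comp σ fun i => c i • toReal (p i)
  · rw [← hsum]
    exact Equiv.sum_comp σ c

theorem eq_convexHull_of_enumerates {P : Set (Fin 3 → ℝ)} (hP : IsLatticePolytope P)
    {p : Fin 5 → Fin 3 → ℤ} (hp : EnumeratesLatticePoints P p) :
    P = convexHull ℝ (toReal '' Set.range p) := by
  obtain ⟨S, rfl⟩ := hP
  refine Set.Subset.antisymm (convexHull_mono (Set.image_mono fun x hx => ?_))
    (convexHull_min ?_ (convex_convexHull ℝ _))
  · rw [hp.2]
    exact subset_convexHull ℝ _ ⟨x, hx, rfl⟩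
  · rintro _ ⟨x, hx, rfl⟩
    rw [hp.2] at hx
    exact hx

/-- As `c 3 ≠ 0`, the last point is redundant for the span, so the other three differences already
form a basis. -/
theorem minor_three_ne_zero {P : Set (Fin 3 → ℝ)} {p : Fin 5 → Fin 3 → ℝ}
    (hP : P = convexHull ℝ (Set.range p)) (hfull : IsFullDimensional P) {c : Fin 4 → ℝ}
    (hc : ∀ j, ∑ i, c i * (p i.succ j - p 0 j) = 0) (hc3 : c 3 ≠ 0) :
    minors (fun i j => p i.succ j - p 0 j) 3 ≠ 0 := by
  obtain ⟨q, hq, hqP⟩ := hfull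
  have htop : affineSpan ℝ (Set.range p) = ⊤ := by
    rw [eq_top_iff, ← hq.affineSpan_eq_top_iff_card_eq_finrank_add_one.2 (by simp),
      ← affineSpan_convexHull (Set.range p), ← hP]
    refine affineSpan_mono ℝ ?_
    rintro _ ⟨i, rfl⟩
    exact hqP i
  have hvec : vectorSpan ℝ (Set.range p) = ⊤ := by
    rw [← direction_affineSpan, htop, AffineSubspace.direction_top]
  rw [vectorSpan_range_eq_span_range_vsub_right ℝ p 0] at hvec
  set B : Fin 3 → Fin 3 → ℝ := ![p 1 - p 0, p 2 - p 0, p 3 - p 0] with hB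
  have hmem : ∀ i, p i -ᵥ p 0 ∈ Submodule.span ℝ (Set.range B) := by
    have hs : ∀ i : Fin 3, B i ∈ Submodule.span ℝ (Set.range B) := fun i =>
      Submodule.subset_span ⟨i, rfl⟩
    intro i
    fin_cases i
    · simp
    · exact hs 0
    · exact hs 1
    · exact hs 2
    · have : p 4 -ᵥ p 0 = -(c 3)⁻¹ • (c 0 • B 0 + c 1 • B 1 + c 2 • B 2) := by
        ext j
        have := hc j
        rw [Fin.sum_univ_four] at this
        simp only [hB, vsub_eq_sub, Pi.sub_apply, Pi.add_apply, Pi.smul_apply, smul_eq_mul,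
          Matrix.cons_val]
        field_simp
        change _ + c 3 * (p 4 j - p 0 j) = 0 at this
        change c 0 * (p 1 j - p 0 j) + c 1 * (p 2 j - p 0 j) + c 2 * (p 3 j - p 0 j) + _ = 0 at this
        linarith
      change p 4 -ᵥ p 0 ∈ _
      rw [this]
      exact Submodule.smul_mem _ _ (add_mem (add_mem (Submodule.smul_mem _ _ (hs 0))
        (Submodule.smul_mem _ _ (hs 1))) (Submodule.smul_mem _ _ (hs 2)))
  have hspan : ⊤ ≤ Submodule.span ℝ (Set.range B) := by
    rw [← hvec, Submodule.span_le]
    rintro _ ⟨i, rfl⟩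
    exact hmem i
  have hli : LinearIndependent ℝ B :=
    linearIndependent_of_top_le_span_of_card_eq_finrank hspan (by simp)
  have hunit := (Matrix.isUnit_iff_isUnit_det _).1
    (Matrix.linearIndependent_rows_iff_isUnit (A := Matrix.of B) |>.1 hli)
  have hdet : (Matrix.of B).det = -minors (fun i j => p i.succ j - p 0 j) 3 := by
    rw [Matrix.det_fin_three]
    simp only [hB, Matrix.of_apply, minors, det3, Matrix.cons_val, Pi.sub_apply]
    change _ = - -(((p 1 0 - p 0 0) * ((p 2 1 - p 0 1) * (p 3 2 - p 0 2) -
      (p 2 2 - p 0 2) * (p 3 1 - p 0 1))) - (p 1 1 - p 0 1) * ((p 2 0 - p 0 0) * (p 3 2 - p 0 2) -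
      (p 2 2 - p 0 2) * (p 3 0 - p 0 0)) + (p 1 2 - p 0 2) * ((p 2 0 - p 0 0) * (p 3 1 - p 0 1) -
      (p 2 1 - p 0 1) * (p 3 0 - p 0 0)))
    ring
  intro h0
  rw [hdet, h0, neg_zero] at hunit
  exact not_isUnit_zero hunit

theorem minors_intCast (A : Fin 4 → Fin 3 → ℤ) (i : Fin 4) :
    minors (fun i j => (A i j : ℝ)) i = ((minors A i : ℤ) : ℝ) := by
  fin_cases i <;> simp [minors, det3]

/-- A polytope of size five and signature `(4, 1)` is, up to translation, a simplex with only one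
lattice point besides the vertices, and the weights are the maximal minors up to a sign. -/
theorem exists_hasOnlyInteriorPoint {P : Set (Fin 3 → ℝ)} (hP : IsLatticePolytope P)
    (hfull : IsFullDimensional P) (hsig : HasSignature P 4 1) :
    ∃ (p : Fin 5 → Fin 3 → ℤ) (w : Fin 4 → ℤ) (s : ℤ),
      EnumeratesLatticePoints P p ∧ s * s = 1 ∧
      (∀ i, w i = s * minors (fun i j => p i.succ j - p 0 j) i) ∧ (∀ i, w i ≤ w 3) ∧
      HasOnlyInteriorPoint (∑ i, w i) (fun i j => p i.succ j - p 0 j) w := by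
  obtain ⟨p, c, hp, hdep, hsum, -, hpos, hmax⟩ := exists_sorted_enumeration hsig
  have hull := eq_convexHull_of_enumerates hP hp
  set A : Fin 4 → Fin 3 → ℤ := fun i j => p i.succ j - p 0 j with hA
  have hcA : ∀ j, ∑ i : Fin 4, c i.succ * (A i j : ℝ) = 0 := by
    intro j
    have h1 := congrFun hdep j
    simp only [Finset.sum_apply, Pi.smul_apply, smul_eq_mul, Pi.zero_apply, toReal] at h1
    rw [Fin.sum_univ_succ] at h1 hsum
    simp only [hA, Int.cast_sub, mul_sub, Finset.sum_sub_distrib, ← Finset.sum_mul]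
    linear_combination h1 - (p 0 j : ℝ) * hsum
  have hm3 : minors A 3 ≠ 0 := by
    have := minor_three_ne_zero (p := fun i => toReal (p i)) (c := fun i => c i.succ)
      (by rw [hull, ← Set.range_comp]; rfl) hfull (fun j => by
        rw [← hcA j]; simp [hA, toReal]) (hpos 3).ne'
    intro h0
    refine this ?_
    have e := minors_intCast A 3
    rw [h0, Int.cast_zero] at e
    rw [← e]
    congr 1
    ext i j
    simp [hA, toReal]
  have hprop : ∀ i j, c i.succ * ((minors A j : ℤ) : ℝ) = c j.succ * ((minors A i : ℤ) : ℝ) := by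
    intro i j
    have := mul_minors_comm (fun i j => (A i j : ℝ)) (c := fun i => c i.succ) hcA i j
    rwa [minors_intCast, minors_intCast] at this
  set s : ℤ := (minors A 3).sign with hs
  have hss : s * s = 1 := by
    rcases lt_or_gt_of_ne hm3 with h | h
    · rw [hs, Int.sign_eq_neg_one_of_neg h]; rfl
    · rw [hs, Int.sign_eq_one_of_pos h]; rfl
  have hs3 : 0 < s * minors A 3 := by
    rcases lt_or_gt_of_ne hm3 with h | h
    · rw [hs, Int.sign_eq_neg_one_of_neg h]; simpa using h
    · rw [hs, Int.sign_eq_one_of_pos h]; simpa using h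
  set w : Fin 4 → ℤ := fun i => s * minors A i with hw
  have hprop' : ∀ i j, c i.succ * (w j : ℝ) = c j.succ * (w i : ℝ) := by
    intro i j
    simp only [hw, Int.cast_mul]
    linear_combination (s : ℝ) * hprop i j
  have hw3 : (0 : ℝ) < w 3 := by exact_mod_cast hs3
  have hwpos : ∀ i, 0 < w i := by
    intro i
    have h1 := hprop' i 3
    have h2 : 0 < c (Fin.succ 3) * (w i : ℝ) := h1 ▸ mul_pos (hpos i) hw3
    exact_mod_cast pos_of_mul_pos_right h2 (hpos 3).le
  have hwA : ∀ j, ∑ i, w i * A i j = 0 := by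
    intro j
    simp only [hw, mul_assoc, ← Finset.mul_sum, sum_minors_mul, mul_zero]
  -- All dependences are proportional to `w`, so one is determined by its coefficient sum.
  have huniq : ∀ d : Fin 4 → ℤ, (∀ j, ∑ i, d i * A i j = 0) →
      ∀ i, d i * ∑ j, w j = (∑ j, d j) * w i := by
    intro d hd i
    rw [Finset.mul_sum, Finset.sum_mul]
    refine Finset.sum_congr rfl fun j _ => ?_
    simp only [hw]
    linear_combination s * mul_minors_comm A hd i j
  have hN : 0 < ∑ i, w i := Finset.sum_pos (fun i _ => hwpos i) Finset.univ_nonempty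
  refine ⟨p, w, s, hp, hss, fun i => rfl, fun i => ?_, hwpos, rfl, ⟨dvd_rfl, fun j => ?_⟩, ?_⟩
  · have h1 := hprop' i 3
    have h2 : c (Fin.succ 3) * (w i : ℝ) ≤ c (Fin.succ 3) * w 3 := by
      rw [← h1]
      exact mul_le_mul_of_nonneg_right (hmax i) hw3.le
    exact_mod_cast le_of_mul_le_mul_left h2 (hpos 3)
  · rw [hwA]
    exact dvd_zero _
  · intro d ⟨_, hdA⟩ hd0 hdsum
    choose x hx using hdA
    replace hx : ∀ j, ∑ i, d i * A i j = (∑ i, w i) * x j := hx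
    set N := ∑ i, w i with hNdef
    have hNR : (0 : ℝ) < N := by exact_mod_cast hN
    have hmemP : (fun j => x j + p 0 j) ∈ latticePoints P := by
      have hin : ∑ i : Fin 4, ((d i : ℝ) / N) • toReal (p i.succ) ∈ P := by
        have hconv : Convex ℝ P := hull ▸ convex_convexHull ℝ _
        refine hconv.sum_mem (fun i _ => div_nonneg (by exact_mod_cast hd0 i) hNR.le) ?_ fun i _ => ?_
        · rw [← Finset.sum_div, div_eq_one_iff_eq hNR.ne']
          exact_mod_cast hdsum
        · have : p i.succ ∈ latticePoints P := hp.2 ▸ ⟨_, rfl⟩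
          exact this
      change toReal _ ∈ P
      convert hin using 1
      ext j
      have h1 : ((∑ i, d i * A i j : ℤ) : ℝ) = ((N * x j : ℤ) : ℝ) := by rw [hx]
      have h2 : ((∑ i, d i : ℤ) : ℝ) = N := by rw [hdsum]
      simp only [hA, mul_sub, Finset.sum_sub_distrib, ← Finset.sum_mul, hdsum] at h1
      push_cast at h1
      simp only [toReal, Finset.sum_apply, Pi.smul_apply, smul_eq_mul, div_mul_eq_mul_div,
        ← Finset.sum_div]
      rw [eq_div_iff hNR.ne']
      push_cast
      linarith
    rw [← hp.2] at hmemP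
    obtain ⟨i, hi⟩ := hmemP
    rcases Fin.eq_zero_or_eq_succ i with rfl | ⟨i, rfl⟩
    · left
      have hx0 : ∀ j, x j = 0 := fun j => by
        have := congrFun hi j
        omega
      have := huniq d fun j => by rw [hx, hx0, mul_zero]
      ext l
      have := this l
      rw [hdsum, mul_comm] at this
      exact mul_left_cancel₀ hN.ne' this
    · right
      refine ⟨i, ?_⟩
      have hxi : ∀ j, x j = A i j := fun j => by
        have := congrFun hi j
        simp only [hA]
        omega
      -- This difference is a dependence with coefficient sum zero, hence vanishes.
      have := huniq (d - Pi.single i N) fun j => by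
        have e : ∑ l, (Pi.single i N : Fin 4 → ℤ) l * A l j = N * A i j := by
          rw [Finset.sum_eq_single i (fun b _ hb => by simp [Pi.single_eq_of_ne hb]) (by simp)]
          simp
        simp only [Pi.sub_apply, sub_mul, Finset.sum_sub_distrib]
        rw [e, hx, hxi, sub_self]
      ext l
      have := this l
      have e : ∑ l, (Pi.single i N : Fin 4 → ℤ) l = N := by simp
      simp only [Pi.sub_apply, Finset.sum_sub_distrib, hdsum] at this
      rw [e, sub_self, zero_mul] at this
      rcases mul_eq_zero.1 this with h | h
      · omega
      · exact absurd h hN.ne'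

/-! ### Lattice equivalence from equal weights. -/

theorem det_eq_intCast_of_mapsTo {f : (Fin 3 → ℝ) →ₗ[ℝ] (Fin 3 → ℝ)}
    (hf : ∀ x : Fin 3 → ℤ, ∃ y : Fin 3 → ℤ, f (toReal x) = toReal y) :
    ∃ z : ℤ, LinearMap.det f = z := by
  choose y hy using hf
  refine ⟨(Matrix.of fun i j => y (Pi.single j 1) i).det, ?_⟩
  rw [← LinearMap.det_toMatrix', Int.cast_det]
  congr 1
  ext i j
  rw [LinearMap.toMatrix'_apply]
  have hsingle : (Pi.single j 1 : Fin 3 → ℝ) = toReal (Pi.single j 1) := by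
    ext l
    simp [toReal, Pi.single_apply]
  rw [hsingle, hy]
  rfl

/-- A linear automorphism that preserves the integer lattice has determinant `±1`. -/
theorem abs_det_eq_one_of_mapsTo (T : (Fin 3 → ℝ) ≃ₗ[ℝ] (Fin 3 → ℝ))
    (h : ∀ x : Fin 3 → ℤ, ∃ y : Fin 3 → ℤ, T (toReal x) = toReal y)
    (h' : ∀ y : Fin 3 → ℤ, ∃ x : Fin 3 → ℤ, T (toReal x) = toReal y) :
    |LinearMap.det (T : (Fin 3 → ℝ) →ₗ[ℝ] (Fin 3 → ℝ))| = 1 := by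
  obtain ⟨z, hz⟩ := det_eq_intCast_of_mapsTo (f := T) h
  obtain ⟨z', hz'⟩ := det_eq_intCast_of_mapsTo (f := T.symm) fun y => by
    obtain ⟨x, hx⟩ := h' y
    exact ⟨x, by rw [← hx]; simp⟩
  have hmul : z * z' = 1 := by
    have := T.det_mul_det_symm
    rw [hz, hz'] at this
    exact_mod_cast this
  rw [hz, ← Int.cast_abs, Int.isUnit_iff_abs_eq.1 (IsUnit.of_mul_eq_one _ hmul), Int.cast_one]

/-- Vectors with a common linear dependence that both generate the integer lattice are related by
a linear automorphism of the lattice. -/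
theorem exists_latticeAutomorphism {A B : Fin 4 → Fin 3 → ℤ} {w : Fin 4 → ℤ} (hw3 : w 3 ≠ 0)
    (hwA : ∀ j, ∑ i, w i * A i j = 0) (hwB : ∀ j, ∑ i, w i * B i j = 0)
    (hA3 : minors A 3 ≠ 0)
    (hA : ∀ x : Fin 3 → ℤ, ∃ e : Fin 4 → ℤ, ∀ j, x j = ∑ l, e l * A l j)
    (hB : ∀ x : Fin 3 → ℤ, ∃ e : Fin 4 → ℤ, ∀ j, x j = ∑ l, e l * B l j) :
    ∃ T : (Fin 3 → ℝ) ≃ₗ[ℝ] (Fin 3 → ℝ), (∀ i, T (toReal (A i)) = toReal (B i)) ∧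
      (∀ x : Fin 3 → ℤ, ∃ y : Fin 3 → ℤ, T (toReal x) = toReal y) ∧
      ∀ y : Fin 3 → ℤ, ∃ x : Fin 3 → ℤ, T (toReal x) = toReal y := by
  have hli : LinearIndependent ℝ fun i : Fin 3 => toReal (A i.castSucc) := by
    refine (Matrix.linearIndependent_rows_iff_isUnit
      (A := Matrix.of fun i : Fin 3 => toReal (A i.castSucc))).2 ?_
    rw [Matrix.isUnit_iff_isUnit_det, isUnit_iff_ne_zero, Matrix.det_fin_three]
    intro h0
    refine hA3 ?_
    have e : ((minors A 3 : ℤ) : ℝ) = 0 := by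
      rw [← neg_eq_zero, ← h0]
      simp only [minors, det3, Matrix.cons_val, Matrix.of_apply, toReal]
      push_cast
      change _ = (A 0 0 : ℝ) * A 1 1 * A 2 2 - A 0 0 * A 1 2 * A 2 1 - A 0 1 * A 1 0 * A 2 2 +
        A 0 1 * A 1 2 * A 2 0 + A 0 2 * A 1 0 * A 2 1 - A 0 2 * A 1 1 * A 2 0
      ring
    exact_mod_cast e
  let b := basisOfLinearIndependentOfCardEqFinrank hli (by simp)
  let f : (Fin 3 → ℝ) →ₗ[ℝ] (Fin 3 → ℝ) := b.constr ℝ fun i : Fin 3 => toReal (B i.castSucc)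
  have hf : ∀ i : Fin 3, f (toReal (A i.castSucc)) = toReal (B i.castSucc) := by
    intro i
    have := b.constr_basis ℝ (fun i : Fin 3 => toReal (B i.castSucc)) i
    rwa [coe_basisOfLinearIndependentOfCardEqFinrank] at this
  have hsum : ∀ (C : Fin 4 → Fin 3 → ℤ) (e : Fin 4 → ℤ),
      toReal (fun j => ∑ l, e l * C l j) = ∑ l, (e l : ℝ) • toReal (C l) := by
    intro C e
    ext j
    simp [toReal]
  have hz : ∀ C : Fin 4 → Fin 3 → ℤ, (∀ j, ∑ i, w i * C i j = 0) →
      ∑ l, (w l : ℝ) • toReal (C l) = 0 := by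
    intro C hC
    rw [← hsum, funext hC]
    ext j
    simp [toReal]
  -- For the last vector this is forced by the common dependence, as `w 3 ≠ 0`.
  have hfA : ∀ i, f (toReal (A i)) = toReal (B i) := by
    intro i
    refine Fin.lastCases ?_ hf i
    have hwR : (w (Fin.last 3) : ℝ) ≠ 0 := by exact_mod_cast hw3
    have e1 := congrArg f (hz A hwA)
    have e2 := hz B hwB
    rw [Fin.sum_univ_castSucc] at e1 e2
    simp only [map_add, map_sum, map_smul, hf, map_zero] at e1
    rw [← e2] at e1
    exact smul_right_injective _ hwR (add_left_cancel e1)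
  have hfe : ∀ e : Fin 4 → ℤ, f (toReal fun j => ∑ l, e l * A l j) =
      toReal fun j => ∑ l, e l * B l j := by
    intro e
    simp only [hsum, map_sum, map_smul, hfA]
  have hf1 : ∀ x : Fin 3 → ℤ, ∃ y : Fin 3 → ℤ, f (toReal x) = toReal y := by
    intro x
    obtain ⟨e, he⟩ := hA x
    exact ⟨_, by rw [funext he, hfe]⟩
  have hf2 : ∀ y : Fin 3 → ℤ, ∃ x : Fin 3 → ℤ, f (toReal x) = toReal y := by
    intro y
    obtain ⟨e, he⟩ := hB y
    exact ⟨fun j => ∑ l, e l * A l j, by rw [hfe, ← funext he]⟩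
  have hsurj : Function.Surjective f := by
    rw [← LinearMap.range_eq_top, eq_top_iff, ← (Pi.basisFun ℝ (Fin 3)).span_eq, Submodule.span_le]
    rintro _ ⟨i, rfl⟩
    obtain ⟨x, hx⟩ := hf2 (Pi.single i 1)
    refine ⟨toReal x, hx.trans ?_⟩
    ext l
    simp [toReal, Pi.single_apply]
  exact ⟨LinearEquiv.ofBijective f ⟨LinearMap.injective_iff_surjective.2 hsurj, hsurj⟩, hfA, hf1, hf2⟩

theorem exists_perm_of_multiset_eq {n : ℕ} {f g : Fin n → ℤ}
    (h : Finset.univ.val.map f = Finset.univ.val.map g) : ∃ σ : Equiv.Perm (Fin n), f = g ∘ σ := by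
  rw [Fin.univ_val_map, Fin.univ_val_map, Multiset.coe_eq_coe] at h
  have hs : f ∘ Tuple.sort f = g ∘ Tuple.sort g := List.ofFn_injective <|
    (((Tuple.sort f).ofFn_comp_perm f).trans (h.trans
      ((Tuple.sort g).ofFn_comp_perm g).symm)).eq_of_pairwise'
      (Tuple.monotone_sort f).sortedLE_ofFn.pairwise (Tuple.monotone_sort g).sortedLE_ofFn.pairwise
  refine ⟨(Tuple.sort f).symm.trans (Tuple.sort g), funext fun i => ?_⟩
  have := congrFun hs ((Tuple.sort f).symm i)
  simpa using this

/-- The weights are minors up to sign, so their coprimality makes the vertices generate `ℤ³`. -/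
theorem exists_bezout_configVolumeVector (j : Fin 6) :
    ∃ β : Fin 4 → ℤ, ∑ i, β i * configVolumeVector j i.succ = 1 := by
  fin_cases j
  · exact ⟨![1, 0, 0, 0], by decide⟩
  · exact ⟨![1, 0, 0, 0], by decide⟩
  · exact ⟨![1, 0, 0, 0], by decide⟩
  · exact ⟨![-1, 1, 0, 0], by decide⟩
  · exact ⟨![1, 0, -1, 0], by decide⟩
  · exact ⟨![1, -1, 0, 0], by decide⟩

theorem configVolumeVector_succ (j : Fin 6) (i : Fin 4) :
    configVolumeVector j i.succ = -minors (fun i => config j i.succ) i ∨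
    configVolumeVector j i.succ = minors (fun i => config j i.succ) i := by
  revert j i
  decide

theorem config_generates (j : Fin 6) (x : Fin 3 → ℤ) :
    ∃ e : Fin 4 → ℤ, ∀ l, x l = ∑ i, e i * config j i.succ l := by
  obtain ⟨β, hβ⟩ := exists_bezout_configVolumeVector j
  have : ∀ i, ∃ t : ℤ, configVolumeVector j i.succ = t * minors (fun i => config j i.succ) i :=
    fun i => (configVolumeVector_succ j i).elim (fun h => ⟨-1, by rw [h]; ring⟩)
      fun h => ⟨1, by rw [h]; ring⟩
  choose t ht using this
  refine exists_combination_of_sum_minors _ (β := fun i => β i * t i) ?_ x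
  rw [← hβ]
  exact Finset.sum_congr rfl fun i _ => by rw [ht, mul_assoc]

theorem zEquivalent_configPolytope {P : Set (Fin 3 → ℝ)} {p : Fin 5 → Fin 3 → ℤ} {w : Fin 4 → ℤ}
    {s : ℤ} (hull : P = convexHull ℝ (toReal '' Set.range p))
    (hw : ∀ i, w i = s * minors (fun i j => p i.succ j - p 0 j) i) (hw3 : 0 < w 3)
    {j : Fin 6} {σ : Equiv.Perm (Fin 4)} (hσ : ∀ i, w i = configVolumeVector j (σ i).succ) :
    ZEquivalent P (configPolytope j) := by
  set A : Fin 4 → Fin 3 → ℤ := fun i j => p i.succ j - p 0 j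
  obtain ⟨β, hβ⟩ := exists_bezout_configVolumeVector j
  have hA : ∀ x : Fin 3 → ℤ, ∃ e : Fin 4 → ℤ, ∀ l, x l = ∑ i, e i * A i l := by
    refine exists_combination_of_sum_minors A (β := fun i => β (σ i) * s) ?_
    rw [← hβ, ← Equiv.sum_comp σ fun i => β i * configVolumeVector j i.succ]
    exact Finset.sum_congr rfl fun i _ => by rw [← hσ, hw, mul_assoc]
  obtain ⟨T, hT, hT1, hT2⟩ := exists_latticeAutomorphism (A := A)
    (B := fun i => config j (σ i).succ) (w := w) hw3.ne' (fun l => by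
      simp only [hw, mul_assoc, ← Finset.mul_sum, sum_minors_mul, mul_zero]) (fun l => by
      simp only [hσ]
      rw [Equiv.sum_comp σ fun i => configVolumeVector j i.succ * config j i.succ l]
      have := congrFun (sum_configVolumeVector_smul j) l
      rw [Fin.sum_univ_succ] at this
      simpa [show config j 0 = 0 from by ext l; fin_cases l <;> rfl] using this)
    (fun h => by rw [hw, h, mul_zero] at hw3; exact hw3.false) hA (fun x => by
      obtain ⟨e, he⟩ := config_generates j x
      exact ⟨e ∘ σ, fun l => (he l).trans
        (Equiv.sum_comp σ fun i => e i * config j i.succ l).symm⟩)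
  let t : (Fin 3 → ℝ) ≃ᵃ[ℝ] (Fin 3 → ℝ) :=
    (AffineEquiv.constVAdd ℝ (Fin 3 → ℝ) (-toReal (p 0))).trans T.toAffineEquiv
  have ht : ∀ y, t y = T (y - toReal (p 0)) := fun y => by
    simp [t, sub_eq_neg_add]
  have hsub : ∀ x y : Fin 3 → ℤ, toReal x - toReal y = toReal (x - y) := fun x y => by
    ext l
    simp [toReal]
  have htp : ∀ i : Fin 4, t (toReal (p i.succ)) = toReal (config j (σ i).succ) := fun i => by
    rw [ht, hsub]
    exact hT i
  have ht0 : t (toReal (p 0)) = toReal (config j 0) := by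
    rw [ht, sub_self, map_zero]
    ext l
    fin_cases l <;> simp [toReal, config]
  refine ⟨t, ?_, ?_, ?_⟩
  · exact abs_det_eq_one_of_mapsTo T hT1 hT2
  · refine Set.Subset.antisymm ?_ ?_
    · rintro _ ⟨_, ⟨x, rfl⟩, rfl⟩
      rw [ht, hsub]
      obtain ⟨y, hy⟩ := hT1 (x - p 0)
      exact ⟨y, hy.symm⟩
    · rintro _ ⟨y, rfl⟩
      obtain ⟨x, hx⟩ := hT2 y
      refine ⟨_, ⟨x + p 0, rfl⟩, ?_⟩
      rw [ht, hsub, add_sub_cancel_right, hx]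
  · rw [hull, configPolytope]
    have := AffineMap.image_convexHull (t : (Fin 3 → ℝ) →ᵃ[ℝ] (Fin 3 → ℝ)) (toReal '' Set.range p)
    refine this.trans (congrArg _ (Set.Subset.antisymm ?_ ?_))
    · rintro _ ⟨_, ⟨_, ⟨i, rfl⟩, rfl⟩, rfl⟩
      refine Fin.cases ?_ (fun i => ?_) i
      · exact ⟨_, ⟨0, rfl⟩, ht0.symm⟩
      · exact ⟨_, ⟨_, rfl⟩, (htp i).symm⟩
    · rintro _ ⟨_, ⟨i, rfl⟩, rfl⟩
      refine Fin.cases ?_ (fun i => ?_) i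
      · exact ⟨_, ⟨_, ⟨0, rfl⟩, rfl⟩, ht0⟩
      · refine ⟨_, ⟨_, ⟨(σ.symm i).succ, rfl⟩, rfl⟩, (htp _).trans ?_⟩
        rw [Equiv.apply_symm_apply]

/-- Identifies equal weights with the excluded family: the interior point splits the simplex into
four tetrahedra of volume `q`, whence the coefficient `-4 * q`. -/
theorem isVolumeVector_of_minors {p : Fin 5 → Fin 3 → ℤ} {q s : ℤ} (hs : s * s = 1) (hq : 0 < q)
    (hw : ∀ i, q = s * minors (fun i j => p i.succ j - p 0 j) i) :
    IsVolumeVector p ![-4 * q, q, q, q, q] := by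
  have habs : |s| = 1 := Int.isUnit_iff_abs_eq.1 (IsUnit.of_mul_eq_one _ hs)
  have hm : ∀ i, minors (fun i j => p i.succ j - p 0 j) i = s * q := fun i => by
    rw [hw i, ← mul_assoc, hs, one_mul]
  have h0 := hm 0
  have h1 := hm 1
  have h2 := hm 2
  have h3 := hm 3
  have hsq : |s * q| = q := by rw [abs_mul, habs, one_mul, abs_of_pos hq]
  refine ⟨?_, ?_, ?_⟩
  · ext l
    have := sum_minors_mul (fun i j => p i.succ j - p 0 j) l
    simp only [hm] at this
    rw [← Finset.mul_sum, mul_assoc, mul_eq_zero] at this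
    have hs0 : s ≠ 0 := by rintro rfl; simp at hs
    have := this.resolve_left hs0
    rw [Fin.sum_univ_four] at this
    rw [Finset.sum_apply]
    change ∑ i : Fin 5, ![-4 * q, q, q, q, q] i * p i l = 0
    rw [Fin.sum_univ_five]
    simp only [Matrix.cons_val]
    change q * (p 1 l - p 0 l + (p 2 l - p 0 l) + (p 3 l - p 0 l) + (p 4 l - p 0 l)) = 0 at this
    linarith
  · simp [Fin.sum_univ_five]
    ring
  · have e0 : det3 (p 2 - p 1) (p 3 - p 1) (p 4 - p 1) = 4 * (s * q) := by
      have : 4 * (s * q) = s * q + s * q + s * q + s * q := by ring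
      rw [this]
      nth_rewrite 1 [← h0]
      nth_rewrite 1 [← h1]
      nth_rewrite 1 [← h2]
      rw [← h3]
      simp only [minors, det3, Matrix.cons_val, Pi.sub_apply, Fin.isValue, Fin.succ_zero_eq_one,
        Fin.succ_one_eq_two, Fin.reduceSucc]
      ring
    intro i
    rw [normalizedVolume_eq]
    fin_cases i
    · change |-4 * q| = |det3 (p 2 - p 1) (p 3 - p 1) (p 4 - p 1)|
      rw [e0, abs_mul, abs_mul, hsq, abs_of_pos hq]
      rfl
    · change |q| = |det3 (p 2 - p 0) (p 3 - p 0) (p 4 - p 0)|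
      rw [abs_of_pos hq, ← hsq, ← h0]
      rfl
    · change |q| = |det3 (p 1 - p 0) (p 3 - p 0) (p 4 - p 0)|
      rw [abs_of_pos hq, ← hsq, ← h1]
      exact abs_neg _
    · change |q| = |det3 (p 1 - p 0) (p 2 - p 0) (p 4 - p 0)|
      rw [abs_of_pos hq, ← hsq, ← h2]
      rfl
    · change |q| = |det3 (p 1 - p 0) (p 2 - p 0) (p 3 - p 0)|
      rw [abs_of_pos hq, ← hsq, ← h3]
      exact abs_neg _

theorem mainTheorem9 :
    (∀ k : Fin 6,
      EnumeratesLatticePoints (configPolytope k) (config k) ∧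
      HasSignature (configPolytope k) 4 1 ∧
      IsVolumeVector (config k) (configVolumeVector k)) ∧
    ∀ P : Set (Fin 3 → ℝ),
      IsLatticePolytope P → IsFullDimensional P → latticeSize P = 5 → HasSignature P 4 1 →
      (¬ ∃ q : ℤ, 0 < q ∧ HasVolumeVector P ![-4 * q, q, q, q, q]) →
      ∃ k : Fin 6, ZEquivalent P (configPolytope k) := by
  refine ⟨fun k => ⟨enumerates_config k, hasSignature_config k, isVolumeVector_config k⟩, ?_⟩
  intro P hP hfull _ hsig hvol
  obtain ⟨p, w, s, hp, hs, hw, hmax, h⟩ := exists_hasOnlyInteriorPoint hP hfull hsig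
  have hne : ¬ ∀ i, w i = w 3 := fun heq => hvol ⟨w 3, h.pos 3, p, hp,
    isVolumeVector_of_minors hs (h.pos 3) fun i => by rw [← heq i, hw i]⟩
  obtain ⟨hNk, hkN⟩ := h.max_weight_bounds hmax hne
  obtain ⟨v, hv, hv3⟩ := h.exists_mem_eq_neg_one hs hw
  obtain ⟨j, hj⟩ := h.weights_eq hNk hkN hv hv3
  obtain ⟨σ, hσ⟩ := exists_perm_of_multiset_eq (f := w) (g := fun i => configVolumeVector j i.succ) hj
  exact ⟨j, zEquivalent_configPolytope (eq_convexHull_of_enumerates hP hp) hw (h.pos 3)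
    (congrFun hσ)⟩
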